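/- \textbf{Setting.} Let $(\mathcal X,\mathscr X)$ and $(\mathcal Y,\mathscr Y)$ be measurable spaces, $\mu$ a $\sigma$-finite measure on $\mathcal Y$, and $n,k\in\mathbb N$. Let $\mathcal Z=\{-1,1\}^k$, and let $z^{\oplus i}$ denote $z$ with the sign of its $i$-th coordinate flipped. Let $\{\mathbf p_z\}_{z\in\mathcal Z}$ be probability measures on $\mathcal X$ such that for all $z\in\mathcal Z$, $i\in[k]$ we have $\mathbf p_{z^{\oplus i}}\ll\mathbf p_z$ and $$\frac{d\mathbf p_{z^{\oplus i}}}{d\mathbf p_z}=1+\alpha_{z,i}\,\phi_{z,i}\quad(\mathbf p_z\text{-a.e.}),\qquad |\alpha_{z,i}|\le\alpha,$$ where $\phi_{z,i}\colon\mathcal X\to\mathbb R$ is measurable and the constant $\alpha$ does not depend on $z,i$. \textbf{Protocols.} Let $\mathcal W^\ast$ be a collection of sequences $(\mathcal W_t,j_t)_{t\ge1}$, where each $\mathcal W_t$ is a set of kernels from $\mathcal X$ to $\mathcal Y$ and $j_t\in[n]$. A \emph{fully interactive protocol} $\Pi$ using $\mathcal W^\ast$ consists of a random variable $U$ (public randomness,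 with values in some measurable space), independent of the inputs $X_1,\dots,X_n\in\mathcal X$, and, for every $t\ge1$, measurable maps $\sigma_t\colon(y^{t-1},U)\mapsto N_t\in[n]\cup\{\bot\}$ and $(y^{t-1},U)\mapsto W_t$, where $W_t$ is a Markov kernel from $\mathcal X$ to $\mathcal Y$ with a density $W_t(y\mid x)=W_t(y\mid x,y^{t-1},U)$ with respect to $\mu$, jointly measurable in all its arguments. It is required that for every value of $U$, every $t$ and every $y^{t-1}\in\mathcal Y^{t-1}$ along which $N_1,\dots,N_t\neq\bot$, there is a sequence $(\mathcal W_s,j_s)_{s\ge1}\in\mathcal W^\ast$ with $W_s\in\mathcal W_s$ and $N_s=j_s$ for all $1\le s\le t$. In round $t$ the protocol ends if $N_t=\bot$; otherwise player $N_t$ sends a message $Y_t$ drawn from $W_t(\cdot\mid X_{N_t})$. Players may speak several times. It is required that the protocol a.s. ends after finitely many rounds when $X_1,\dots,X_n$ are i.i.d. from $\mathbf p_z$, for every $z\in\mathcal Z$. Let $Y^\ast\in\mathcal Y^\ast=\bigsqcup_{m\ge0}\mathcal Y^m$ be the sequence of all messages sent; $(Y^\ast,U)$ is the \emph{transcript}.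 We also write $\mu$ for the measure on $\mathcal Y^\ast$ which is $\mu^{\otimes m}$ on $\mathcal Y^m$. \textbf{Effective channels.} For a protocol without public randomness, call $y^\ast=(y_1,\dots,y_m)\in\mathcal Y^\ast$ \emph{complete} if $\sigma_t(y^{t-1})\neq\bot$ for all $t\le m$ and $\sigma_{m+1}(y^m)=\bot$. For $j\in[n]$ and $x\in\mathcal X$ set $$g_j(y^\ast,x)=\prod_{1\le t\le m:\ \sigma_t(y^{t-1})=j}W_t(y_t\mid x,y^{t-1})$$ if $y^\ast$ is complete, $g_j(y^\ast,x)=0$ otherwise, and $$\widetilde W_{j,\mathbf p_z}(y^\ast\mid x)=g_j(y^\ast,x)\prod_{l\neq j}\mathbb E_{X\sim\mathbf p_z}[g_l(y^\ast,X)].$$ \textbf{Theorem (Information contraction bound, fully interactive).} Fix $\tau\in(0,1/2]$. Let $\Pi$ be a fully interactive protocol using $\mathcal W^\ast$, and let $Z=(Z_1,\dots,Z_k)$ have independent coordinates in $\{-1,1\}$ with $\Pr[Z_i=1]=\tau$. Let $(Y^\ast,U)$ be the transcript of $\Pi$ when, given $Z$, the inputs $X_1,\dots,X_n$ are i.i.d.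 from $\mathbf p_Z$; write $\mathbf p_z^{Y^\ast}$ for the law of $Y^\ast$ when the inputs are i.i.d. from $\mathbf p_z$, and $\mathbf p_{+i}^{Y^\ast}=\mathbb E[\mathbf p_Z^{Y^\ast}\mid Z_i=+1]$, $\mathbf p_{-i}^{Y^\ast}=\mathbb E[\mathbf p_Z^{Y^\ast}\mid Z_i=-1]$. Then $$\Bigl(\frac1k\sum_{i=1}^k d_{\rm TV}\bigl(\mathbf p_{+i}^{Y^\ast},\mathbf p_{-i}^{Y^\ast}\bigr)\Bigr)^2\le\frac7k\,\alpha^2\sum_{j=1}^n\ \max_{z\in\mathcal Z}\ \sup\ \sum_{i=1}^k\int_{\mathcal Y^\ast}\frac{\mathbb E_{\mathbf p_z}\bigl[\phi_{z,i}(X)\,\widetilde W_{j,\mathbf p_z}(y^\ast\mid X)\bigr]^2}{\mathbb E_{\mathbf p_z}\bigl[\widetilde W_{j,\mathbf p_z}(y^\ast\mid X)\bigr]}\,d\mu(y^\ast),$$ where the supremum is over all choices of speakers and channels admissible for $\mathcal W^\ast$, that is, over all fully interactive protocols without public randomness using $\mathcal W^\ast$, and $\widetilde W_{j,\mathbf p_z}$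 is the effective channel of that protocol. Here $d_{\rm TV}(P,Q)=\sup_A|P(A)-Q(A)|$, $0/0=0$, and the right-hand side may be $+\infty$. The same bound holds with the law of the whole transcript $(Y^\ast,U)$ in place of that of $Y^\ast$. -/

import Mathlib

open MeasureTheory ProbabilityTheory
open scoped ENNReal

noncomputable section

namespace FullyInteractive

/-- An interactive protocol for `n` players with public randomness in `𝒰`, inputs in `𝒳` and
messages in `𝒴`. Rounds are numbered from `0`; the history before round `t` is an element of
`Fin t → 𝒴`. After public randomness `u` and history `h`, `speaker t u h` is the player who speaks
in round `t`, or `none` (the stop symbol), and `density t u h x y` is the density `W_t(y ∣ x)`, with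
respect to the reference measure `μ`, of the channel that this player uses. -/
structure Protocol (n : ℕ) (𝒰 𝒳 𝒴 : Type*) [MeasurableSpace 𝒰] [MeasurableSpace 𝒳]
    [MeasurableSpace 𝒴] (μ : Measure 𝒴) where
  speaker : (t : ℕ) → 𝒰 → (Fin t → 𝒴) → Option (Fin n)
  density : (t : ℕ) → 𝒰 → (Fin t → 𝒴) → 𝒳 → 𝒴 → ℝ≥0∞
  measurableSet_speaker : ∀ (t : ℕ) (o : Option (Fin n)),
    MeasurableSet {q : 𝒰 × (Fin t → 𝒴) | speaker t q.1 q.2 = o}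
  measurable_density : ∀ t : ℕ,
    Measurable fun q : 𝒰 × (Fin t → 𝒴) × 𝒳 × 𝒴 => density t q.1 q.2.1 q.2.2.1 q.2.2.2
  lintegral_density : ∀ (t : ℕ) (u : 𝒰) (h : Fin t → 𝒴) (x : 𝒳), ∫⁻ y, density t u h x y ∂μ = 1

/-- The set `𝒴^*` of all finite message sequences, the disjoint union of the powers of `𝒴`. -/
abbrev Messages (𝒴 : Type*) : Type _ := Σ m : ℕ, Fin m → 𝒴

/-- The reference measure on `𝒴^*`, equal to the `m`-fold product of `μ` on `𝒴^m`. -/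
def messagesMeasure {𝒴 : Type*} [MeasurableSpace 𝒴] (μ : Measure 𝒴) : Measure (Messages 𝒴) :=
  Measure.sum fun m : ℕ => (Measure.pi fun _ : Fin m => μ).map
    fun h => (⟨m, h⟩ : Messages 𝒴)

namespace Protocol

variable {n : ℕ} {𝒰 𝒳 𝒴 : Type*} [MeasurableSpace 𝒰] [MeasurableSpace 𝒳] [MeasurableSpace 𝒴]
  {μ : Measure 𝒴} [SigmaFinite μ]

/-- The channel used in round `t`, as a kernel from `𝒳` to `𝒴`. -/
def channel (π : Protocol n 𝒰 𝒳 𝒴 μ) (t : ℕ) (u : 𝒰) (h : Fin t → 𝒴) : Kernel 𝒳 𝒴 :=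
  Kernel.withDensity (Kernel.const 𝒳 μ) (π.density t u h)

/-- `π` uses `𝒲`, a collection of sequences of pairs (channel family, player): along every history
on which the protocol has not stopped, the channels and speakers chosen so far are consistent with
some sequence in `𝒲`. -/
def Uses (π : Protocol n 𝒰 𝒳 𝒴 μ) (𝒲 : Set (ℕ → Set (Kernel 𝒳 𝒴) × Fin n)) : Prop :=
  ∀ (u : 𝒰) (m : ℕ) (y : Fin m → 𝒴),
    (∀ (s : ℕ) (hs : s ≤ m), π.speaker s u (Fin.take s hs y) ≠ none) →
    ∃ w ∈ 𝒲, ∀ (s : ℕ) (hs : s ≤ m),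
      π.channel s u (Fin.take s hs y) ∈ (w s).1 ∧
        π.speaker s u (Fin.take s hs y) = some (w s).2

/-- Round `t`, given the public randomness, the inputs and the history: if player `j` speaks, the
message has law `W_t(· ∣ x_j)`; if the protocol has stopped, no message is sent (zero measure). -/
def roundKernel (π : Protocol n 𝒰 𝒳 𝒴 μ) (t : ℕ) :
    Kernel ((𝒰 × (Fin n → 𝒳)) × (Fin t → 𝒴)) 𝒴 :=
  Kernel.withDensity (Kernel.const _ μ) fun q y =>
    match π.speaker t q.1.1 q.2 with
    | none => 0
    | some j => π.density t q.1.1 q.2 (q.1.2 j) y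

/-- The law of the first `t` messages on the event that the protocol does not stop before `t`
messages have been sent (a sub-probability), given the public randomness and the inputs. -/
def aliveKernel (π : Protocol n 𝒰 𝒳 𝒴 μ) : (t : ℕ) → Kernel (𝒰 × (Fin n → 𝒳)) (Fin t → 𝒴)
  | 0 => Kernel.const _ (Measure.dirac Fin.elim0)
  | t + 1 => (Kernel.compProd (aliveKernel π t) (π.roundKernel t)).map
      fun q => Fin.snoc (α := fun _ => 𝒴) q.1 q.2

instance (π : Protocol n 𝒰 𝒳 𝒴 μ) (t : ℕ) : IsSFiniteKernel (π.aliveKernel t) := by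
  cases t <;> (unfold aliveKernel; infer_instance)

/-- The law of the message sequence `Y^*` of a run, given the public randomness and the inputs. On
`𝒴^t` it is the law of the first `t` messages on the event that the protocol stops right after
them; its total mass is the probability that the protocol stops. -/
def messagesKernel (π : Protocol n 𝒰 𝒳 𝒴 μ) : Kernel (𝒰 × (Fin n → 𝒳)) (Messages 𝒴) :=
  Kernel.sum fun t : ℕ => (Kernel.withDensity (π.aliveKernel t) fun q h =>
    if π.speaker t q.1 h = none then 1 else 0).map
      fun h => (⟨t, h⟩ : Messages 𝒴)

/-- The law of the transcript `(Y^*, U)` when `U ∼ ρ` and, independently, the inputs of the players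
are i.i.d. with law `ν`. -/
def transcriptLaw (π : Protocol n 𝒰 𝒳 𝒴 μ) (ρ : Measure 𝒰) (ν : Measure 𝒳) :
    Measure (Messages 𝒴 × 𝒰) :=
  ((ρ.prod (Measure.pi fun _ : Fin n => ν)).compProd π.messagesKernel).map
    fun q => (q.2, q.1.1)

/-- The law of the message sequence `Y^*`. -/
def messagesLaw (π : Protocol n 𝒰 𝒳 𝒴 μ) (ρ : Measure 𝒰) (ν : Measure 𝒳) :
    Measure (Messages 𝒴) :=
  (π.transcriptLaw ρ ν).map Prod.fst

/-- The protocol stops almost surely. -/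
def StopsAS (π : Protocol n 𝒰 𝒳 𝒴 μ) (ρ : Measure 𝒰) (ν : Measure 𝒳) : Prop :=
  π.transcriptLaw ρ ν Set.univ = 1

/-- `y^*` is the message sequence of a complete run: the protocol does not stop before the last
message of `y^*`, and stops right after it. -/
def IsComplete (π : Protocol n 𝒰 𝒳 𝒴 μ) (u : 𝒰) (y : Messages 𝒴) : Prop :=
  (∀ t : Fin y.1, π.speaker t u (Fin.take t t.2.le y.2) ≠ none) ∧ π.speaker y.1 u y.2 = none

open scoped Classical in
/-- The factor `g_j(y^*, x)` of player `j` in the density of the transcript: the product of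
`W_t(y_t ∣ x, y^{t-1})` over the rounds `t` in which player `j` speaks. It vanishes if `y^*` is not
the message sequence of a complete run. -/
def playerFactor (π : Protocol n 𝒰 𝒳 𝒴 μ) (u : 𝒰) (j : Fin n) (y : Messages 𝒴) (x : 𝒳) : ℝ≥0∞ :=
  if π.IsComplete u y then
    ∏ t : Fin y.1, if π.speaker t u (Fin.take t t.2.le y.2) = some j then
      π.density t u (Fin.take t t.2.le y.2) x (y.2 t) else 1
  else 0

/-- The effective channel `W̃_{j,ν}(y^* ∣ x)` of player `j` when all inputs have law `ν`. -/
def effectiveChannel (π : Protocol n 𝒰 𝒳 𝒴 μ) (u : 𝒰) (ν : Measure 𝒳) (j : Fin n)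
    (y : Messages 𝒴) (x : 𝒳) : ℝ≥0∞ :=
  π.playerFactor u j y x *
    ∏ l ∈ Finset.univ.erase j, ∫⁻ x', π.playerFactor u l y x' ∂ν

/-- `∫_{𝒴^*} E_ν[f(X) W̃_{j,ν}(y^* ∣ X)]² / E_ν[W̃_{j,ν}(y^* ∣ X)] dμ`, with `0 / 0 = 0`. -/
def effectiveInformation (π : Protocol n 𝒰 𝒳 𝒴 μ) (u : 𝒰) (ν : Measure 𝒳) (j : Fin n)
    (f : 𝒳 → ℝ) : ℝ≥0∞ :=
  ∫⁻ y, ENNReal.ofReal ((∫ x, f x * (π.effectiveChannel u ν j y x).toReal ∂ν) ^ 2) /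
    (∫⁻ x, π.effectiveChannel u ν j y x ∂ν) ∂(messagesMeasure μ)

end Protocol

/-- Total variation distance of two finite measures, `sup_A |P(A) - Q(A)|`. -/
def tvDist {Ω : Type*} [MeasurableSpace Ω] (P Q : Measure Ω) : ℝ :=
  ⨆ A : {A : Set Ω // MeasurableSet A}, |P.real A - Q.real A|

/-- The vector `z` with the sign of its `i`-th coordinate flipped; `{-1, 1}` is `ℤˣ`. -/
def flip {k : ℕ} (z : Fin k → ℤˣ) (i : Fin k) : Fin k → ℤˣ := Function.update z i (-z i)

/-- The probability of `z` when its coordinates are independent and equal to `1` with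
probability `τ`. -/
def rademacherWeight {k : ℕ} (τ : ℝ) (z : Fin k → ℤˣ) : ℝ :=
  ∏ i, if z i = 1 then τ else 1 - τ

/-- The mixture `E[L_Z ∣ Z_i = s]` of the measures `L_z`, for `Z` with law `rademacherWeight τ`. -/
def condMixture {k : ℕ} {Ω : Type*} [MeasurableSpace Ω] (τ : ℝ) (L : (Fin k → ℤˣ) → Measure Ω)
    (i : Fin k) (s : ℤˣ) : Measure Ω :=
  ∑ z : Fin k → ℤˣ with z i = s,
    ENNReal.ofReal (rademacherWeight τ z /
      ∑ z' : Fin k → ℤˣ with z' i = s, rademacherWeight τ z') • L z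

/-- `(1/k) ∑_i d_TV(E[L_Z ∣ Z_i = 1], E[L_Z ∣ Z_i = -1])`. -/
def averageDiscrepancy {k : ℕ} {Ω : Type*} [MeasurableSpace Ω] (τ : ℝ)
    (L : (Fin k → ℤˣ) → Measure Ω) : ℝ :=
  1 / (k : ℝ) * ∑ i : Fin k, tvDist (condMixture τ L i 1) (condMixture τ L i (-1))

/-- The densities between neighbouring members of the family exist and have the form
`dp_{z^{⊕i}}/dp_z = 1 + a_{z,i} φ_{z,i}`, with `φ_{z,i}` measurable and `|a_{z,i}| ≤ α`. -/
structure DensitiesExist {k : ℕ} {𝒳 : Type*} [MeasurableSpace 𝒳] (p : (Fin k → ℤˣ) → Measure 𝒳)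
    (α : ℝ) (a : (Fin k → ℤˣ) → Fin k → ℝ) (φ : (Fin k → ℤˣ) → Fin k → 𝒳 → ℝ) : Prop where
  absolutelyContinuous : ∀ z i, p (flip z i) ≪ p z
  abs_le : ∀ z i, |a z i| ≤ α
  measurable : ∀ z i, Measurable (φ z i)
  rnDeriv_eq : ∀ z i,
    (fun x => ((p (flip z i)).rnDeriv (p z) x).toReal) =ᵐ[p z] fun x => 1 + a z i * φ z i x

/-- `(7/k) α² ∑_j max_z max ∑_i ∫ E_{p_z}[φ_{z,i} W̃_{j,p_z}]² / E_{p_z}[W̃_{j,p_z}] dμ`. The inner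
maximum is over all admissible choices of speakers and channels, that is, over the protocols without
public randomness that use `𝒲` and stop almost surely under every `p_z`. -/
def contractionBound {k n : ℕ} {𝒳 𝒴 : Type*} [MeasurableSpace 𝒳] [MeasurableSpace 𝒴]
    (μ : Measure 𝒴) [SigmaFinite μ] (𝒲 : Set (ℕ → Set (Kernel 𝒳 𝒴) × Fin n))
    (p : (Fin k → ℤˣ) → Measure 𝒳) (α : ℝ) (φ : (Fin k → ℤˣ) → Fin k → 𝒳 → ℝ) : ℝ≥0∞ :=
  7 / (k : ℝ≥0∞) * ENNReal.ofReal (α ^ 2) *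
    ∑ j : Fin n, ⨆ (z : Fin k → ℤˣ) (π : Protocol n Unit 𝒳 𝒴 μ) (_ : π.Uses 𝒲)
      (_ : ∀ z', π.StopsAS (Measure.dirac ()) (p z')),
      ∑ i : Fin k, π.effectiveInformation () (p z) j (φ z i)

end FullyInteractive

end

/-!
Two members `p_z`, `p_{flip z i}` of the family induce transcript laws that are both products over
the players: given the public randomness `u`, the density of the message sequence `y` with respect
to the reference measure is `∏_j E[g_j(y, X_j)]`, where `g_j` is `Protocol.playerFactor`
(`Protocol.messagesKernel_apply`, `Protocol.lintegral_transcriptDensity_mul`). For a set `S` of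
players let `f_S` be this density when the players in `S` draw their inputs from `p_{flip z i}` and
the others from `p_z`. The product form gives `f_A f_B = f_{A ∪ B} f_∅` for disjoint `A, B`. Each
`f_S` has total mass one, since the hybrid input law is absolutely continuous with respect to the
i.i.d. one, under which the protocol stops almost surely. Hence the squared Hellinger distance
`D(S) = ∫ (√f_S - √f_∅)²` satisfies the cut-and-paste identity `D(A ∪ B) = ∫ (√f_A - √f_B)²`
(`hellinger_congr_of_mul_eq`).

For points `v_a`, `v` of a Euclidean space, `∑_{a, b} |v_a - v_b|² ≤ 2 m ∑_a |v_a - v|²`; with cut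
and paste, `∑_{a ≠ b} D(A_a ∪ A_b) ≤ 2 m ∑_a D(A_a)` for disjoint `A_1, …, A_m`. So on average over
the pairs, merging two parts increases `∑_a D(A_a)` at most by the factor `1 + 2 / (m (m - 1))`.
Merging all singletons one pair at a time gives `D([n]) ≤ 6 ∑_j D({j})`, because the product of
these factors is below `6` (`apply_biUnion_le`, `hellinger_le_six_mul_sum`).

Finally, `d_TV² ≤ D([n])` (`tvDist_sq_le_hellinger`), and `D({j})` is at most a chi-square
divergence. After fixing `u`, that divergence is `a_{z,i}²` times the effective information of
player `j`, for the protocol in which the public randomness is frozen at `u`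
(`Protocol.lintegral_sq_sqrt_sub_le`). For almost every `u` the frozen protocol is among those over
which the supremum is taken. The passage from the mixtures to the pairs `z, flip z i` is
`exists_averageDiscrepancy_sq_le`: by convexity the squared average is at most the mean over `Z` of
`(1/k) ∑_i d_TV(L_Z, L_{flip Z i})²`, hence at most its value at some `z`.
-/

noncomputable section

namespace FullyInteractive

/-! ### Subadditivity of set functions by merging pairs -/

open Finset in
/-- One step of the merging argument: some two parts can be merged so that the total of `D` grows
at most by the factor `1 + 2 / (m (m - 1))`, because this holds on average over all pairs. -/
theorem exists_merge_le {ι κ : Type*} [DecidableEq ι] [DecidableEq κ] (D : Finset ι → ℝ)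
    (t : Finset κ) (A : κ → Finset ι) (ht : 1 < #t)
    (hD : ∑ a ∈ t, ∑ b ∈ t.erase a, D (A a ∪ A b) ≤ 2 * #t * ∑ a ∈ t, D (A a)) :
    ∃ a ∈ t, ∃ b ∈ t.erase a, (#t : ℝ) * (#t - 1) * (∑ c ∈ t, D (A c) - D (A a) - D (A b) +
      D (A a ∪ A b)) ≤ ((#t : ℝ) * (#t - 1) + 2) * ∑ c ∈ t, D (A c) := by
  by_contra! hcon
  set S := ∑ c ∈ t, D (A c) with hS
  have hm : (1 : ℝ) < #t := by exact_mod_cast ht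
  have hcard : ∀ a ∈ t, ((#(t.erase a) : ℕ) : ℝ) = #t - 1 := fun a ha => by
    rw [card_erase_of_mem ha, Nat.cast_sub ht.le, Nat.cast_one]
  have h1 : ∑ a ∈ t, ∑ b ∈ t.erase a, ((#t : ℝ) * (#t - 1) + 2) * S <
      ∑ a ∈ t, ∑ b ∈ t.erase a,
        (#t : ℝ) * (#t - 1) * (S - D (A a) - D (A b) + D (A a ∪ A b)) := by
    have hne : t.Nonempty := card_pos.mp (by omega)
    refine sum_lt_sum_of_nonempty hne fun a ha => sum_lt_sum_of_nonempty ?_ fun b hb =>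
      hcon a ha b hb
    exact card_pos.mp (by rw [card_erase_of_mem ha]; omega)
  have h2 : ∑ a ∈ t, ∑ b ∈ t.erase a, ((#t : ℝ) * (#t - 1) + 2) * S =
      #t * (#t - 1) * (((#t : ℝ) * (#t - 1) + 2) * S) := by
    rw [sum_congr rfl fun a ha => by rw [sum_const, nsmul_eq_mul, hcard a ha], sum_const,
      nsmul_eq_mul]
    ring
  have h3 : ∑ a ∈ t, ∑ b ∈ t.erase a, (S - D (A a) - D (A b) + D (A a ∪ A b)) =
      #t * (#t - 1) * S - 2 * (#t - 1) * S + ∑ a ∈ t, ∑ b ∈ t.erase a, D (A a ∪ A b) := by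
    have : ∀ a ∈ t, ∑ b ∈ t.erase a, (S - D (A a) - D (A b) + D (A a ∪ A b)) =
        (#t - 1) * S - S - (#t - 2) * D (A a) + ∑ b ∈ t.erase a, D (A a ∪ A b) := by
      intro a ha
      rw [sum_add_distrib, sum_sub_distrib, sum_const, nsmul_eq_mul, hcard a ha]
      have : ∑ b ∈ t.erase a, D (A b) = S - D (A a) := by
        rw [hS, ← add_sum_erase t _ ha]; ring
      rw [this]; ring
    rw [sum_congr rfl this, sum_add_distrib, sum_sub_distrib, sum_const, nsmul_eq_mul, ← mul_sum]
    ring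
  simp only [← mul_sum] at h1
  simp only [← mul_sum] at h2
  rw [h2, h3] at h1
  have hpos : (0 : ℝ) < #t * (#t - 1) := by nlinarith
  have := lt_of_mul_lt_mul_left h1 hpos.le
  linarith

open Finset in
/-- A set function which satisfies the inequality `∑_{a ≠ b} D(A_a ∪ A_b) ≤ 2 m ∑_a D(A_a)` for
disjoint `A_1, …, A_m` is subadditive up to the factor `6 (m - 1) / (m + 1)`. -/
theorem apply_biUnion_le {ι κ : Type*} [DecidableEq ι] [DecidableEq κ] (D : Finset ι → ℝ)
    (hD0 : ∀ s, 0 ≤ D s)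
    (hD : ∀ (t : Finset κ) (A : κ → Finset ι), (t : Set κ).PairwiseDisjoint A →
      ∑ a ∈ t, ∑ b ∈ t.erase a, D (A a ∪ A b) ≤ 2 * #t * ∑ a ∈ t, D (A a))
    (m : ℕ) (hm : 2 ≤ m) (t : Finset κ) (ht : #t = m) (A : κ → Finset ι)
    (hA : (t : Set κ).PairwiseDisjoint A) :
    D (t.biUnion A) ≤ 6 * ((m - 1) / (m + 1)) * ∑ a ∈ t, D (A a) := by
  induction m, hm using Nat.le_induction generalizing t A with
  | base =>
    obtain ⟨a, b, hab, rfl⟩ := card_eq_two.mp ht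
    have h := hD _ A hA
    have e1 : ({a, b} : Finset κ).erase a = {b} := by ext; simp; grind
    have e2 : ({a, b} : Finset κ).erase b = {a} := by ext; simp; grind
    rw [sum_pair hab, e1, e2, sum_singleton, sum_singleton, union_comm (A b), ht] at h
    have e3 : ({a, b} : Finset κ).biUnion A = A a ∪ A b := by ext; simp
    rw [e3]
    norm_num at h ⊢
    linarith
  | succ m hm ih =>
    obtain ⟨a, ha, b, hb, hab⟩ := exists_merge_le D t A (by omega) (hD t A hA)
    obtain ⟨hba, hbt⟩ := mem_erase.mp hb
    set A' : κ → Finset ι := Function.update A a (A a ∪ A b) with hA'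
    have hA'a : A' a = A a ∪ A b := by simp [hA']
    have hA'c : ∀ c, c ≠ a → A' c = A c := fun c hc => by simp [hA', hc]
    have hab' : a ∈ t.erase b := mem_erase.mpr ⟨hba.symm, ha⟩
    have hdisj : ((t.erase b : Finset κ) : Set κ).PairwiseDisjoint A' := by
      intro c hc d hd hcd
      simp only [coe_erase, Set.mem_sdiff, mem_coe, Set.mem_singleton_iff] at hc hd
      by_cases hca : c = a
      · subst hca
        simp only [Function.onFun, hA'a, hA'c d hcd.symm, disjoint_union_left]
        exact ⟨hA ha hd.1 hcd, hA hbt hd.1 (Ne.symm hd.2)⟩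
      · by_cases hda : d = a
        · subst hda
          simp only [Function.onFun, hA'a, hA'c c hcd, disjoint_union_right]
          exact ⟨hA hc.1 ha hcd, hA hc.1 hbt hc.2⟩
        · simp only [Function.onFun, hA'c c hca, hA'c d hda]
          exact hA hc.1 hd.1 hcd
    have hunion : (t.erase b).biUnion A' = t.biUnion A := by
      rw [← insert_erase hab', biUnion_insert, hA'a]
      conv_rhs => rw [← insert_erase hbt, biUnion_insert, ← insert_erase hab', biUnion_insert]
      rw [biUnion_congr rfl fun c hc => hA'c c (mem_erase.mp hc).1, union_comm (A a), union_assoc]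
    have hsum : ∑ c ∈ t.erase b, D (A' c) =
        ∑ c ∈ t, D (A c) - D (A a) - D (A b) + D (A a ∪ A b) := by
      rw [← add_sum_erase _ _ hab', hA'a, ← add_sum_erase t _ hbt, ← add_sum_erase _ _ hab',
        sum_congr rfl fun c hc => by rw [hA'c c (mem_erase.mp hc).1]]
      ring
    have h := ih (t.erase b) (by rw [card_erase_of_mem hbt, ht]; omega) A' hdisj
    rw [hunion, hsum] at h
    rw [ht] at hab
    set S := ∑ c ∈ t, D (A c) with hS
    have hS0 : 0 ≤ S := sum_nonneg fun c _ => hD0 _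
    set T := S - D (A a) - D (A b) + D (A a ∪ A b)
    have hm' : (2 : ℝ) ≤ m := by exact_mod_cast hm
    push_cast at hab ⊢
    refine h.trans ?_
    -- It remains to check `(m - 1) / (m + 1) * (1 + 2 / (m (m + 1))) ≤ m / (m + 2)`.
    have hT : T ≤ (((m : ℝ) + 1) * m + 2) / ((m + 1) * m) * S := by
      rw [div_mul_eq_mul_div, le_div_iff₀ (by positivity)]
      linarith
    refine (mul_le_mul_of_nonneg_left hT (by
      have : (0 : ℝ) ≤ (m - 1) / (m + 1) := div_nonneg (by linarith) (by linarith)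
      positivity)).trans ?_
    rw [← mul_assoc]
    refine mul_le_mul_of_nonneg_right ?_ hS0
    rw [mul_assoc]
    refine mul_le_mul_of_nonneg_left ?_ (by norm_num)
    rw [div_mul_div_comm, div_le_div_iff₀ (by positivity) (by positivity)]
    have : (0 : ℝ) ≤ m + 1 := by positivity
    nlinarith [mul_nonneg this this]

open Finset in
theorem apply_univ_le_six_mul_sum {ι : Type*} [Fintype ι] [DecidableEq ι] (D : Finset ι → ℝ)
    (hD0 : ∀ s, 0 ≤ D s) (hempty : D ∅ = 0)
    (hD : ∀ (t : Finset ι) (A : ι → Finset ι), (t : Set ι).PairwiseDisjoint A →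
      ∑ a ∈ t, ∑ b ∈ t.erase a, D (A a ∪ A b) ≤ 2 * #t * ∑ a ∈ t, D (A a)) :
    D univ ≤ 6 * ∑ j, D {j} := by
  have hun : (univ : Finset ι).biUnion (fun j => {j}) = univ := biUnion_singleton_eq_self
  have hS : 0 ≤ ∑ j, D {j} := sum_nonneg fun _ _ => hD0 _
  rcases lt_or_ge (#(univ : Finset ι)) 2 with h | h
  · rcases Nat.lt_or_ge 0 (#(univ : Finset ι)) with h0 | h0
    · obtain ⟨j, hj⟩ := card_eq_one.mp (show #(univ : Finset ι) = 1 by omega)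
      rw [hj, sum_singleton]
      linarith [hD0 {j}]
    · rw [card_eq_zero.mp (show #(univ : Finset ι) = 0 by omega), hempty]
      simp
  · have := apply_biUnion_le D hD0 hD _ h univ rfl (fun j => {j}) (by
      intro a _ b _ hab
      simpa [Function.onFun] using hab)
    rw [hun] at this
    refine this.trans (mul_le_mul_of_nonneg_right ?_ hS)
    have h1 : ((#(univ : Finset ι) : ℝ) - 1) / (#(univ : Finset ι) + 1) ≤ 1 := by
      rw [div_le_one (by positivity)]; linarith
    linarith

/-! ### Total variation distance and mixtures over the cube -/

section Mixtures

variable {k : ℕ}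

theorem flip_apply_self (z : Fin k → ℤˣ) (i : Fin k) : flip z i i = -z i := by simp [flip]

theorem flip_apply_of_ne (z : Fin k → ℤˣ) {i j : Fin k} (h : j ≠ i) : flip z i j = z j := by
  simp [flip, h]

theorem flip_flip (z : Fin k → ℤˣ) (i : Fin k) : flip (flip z i) i = z := by
  simp [flip]

theorem tvDist_comm {Ω : Type*} [MeasurableSpace Ω] (P Q : Measure Ω) :
    tvDist P Q = tvDist Q P := by
  simp [tvDist, abs_sub_comm]

theorem abs_measureReal_sub_le_tvDist {Ω : Type*} [MeasurableSpace Ω] (P Q : Measure Ω)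
    [IsFiniteMeasure P] [IsFiniteMeasure Q] {A : Set Ω} (hA : MeasurableSet A) :
    |P.real A - Q.real A| ≤ tvDist P Q := by
  refine le_ciSup (f := fun A : {A : Set Ω // MeasurableSet A} => |P.real A - Q.real A|) ?_ ⟨A, hA⟩
  refine ⟨P.real Set.univ + Q.real Set.univ, ?_⟩
  rintro _ ⟨B, rfl⟩
  have h1 : P.real B ≤ P.real Set.univ := measureReal_mono (Set.subset_univ _)
  have h2 : Q.real B ≤ Q.real Set.univ := measureReal_mono (Set.subset_univ _)
  have h3 : 0 ≤ P.real B := measureReal_nonneg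
  have h4 : 0 ≤ Q.real B := measureReal_nonneg
  simp only [abs_le]
  constructor <;> linarith

theorem tvDist_nonneg {Ω : Type*} [MeasurableSpace Ω] (P Q : Measure Ω) : 0 ≤ tvDist P Q :=
  Real.iSup_nonneg fun _ => abs_nonneg _

theorem tvDist_le {Ω : Type*} [MeasurableSpace Ω] {P Q : Measure Ω} {c : ℝ}
    (h : ∀ A, MeasurableSet A → |P.real A - Q.real A| ≤ c) : tvDist P Q ≤ c :=
  haveI : Nonempty {A : Set Ω // MeasurableSet A} := ⟨⟨∅, .empty⟩⟩
  ciSup_le fun A => h A A.2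

theorem tvDist_map_le {Ω Ω' : Type*} [MeasurableSpace Ω] [MeasurableSpace Ω'] (P Q : Measure Ω)
    [IsFiniteMeasure P] [IsFiniteMeasure Q] {T : Ω → Ω'} (hT : Measurable T) :
    tvDist (P.map T) (Q.map T) ≤ tvDist P Q := by
  refine tvDist_le fun A hA => ?_
  rw [map_measureReal_apply hT hA, map_measureReal_apply hT hA]
  exact abs_measureReal_sub_le_tvDist P Q (hT hA)

/-- The weight of all coordinates of `z` except the `i`-th. -/
def weightErase (τ : ℝ) (i : Fin k) (z : Fin k → ℤˣ) : ℝ :=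
  ∏ j ∈ Finset.univ.erase i, if z j = 1 then τ else 1 - τ

theorem rademacherWeight_eq (τ : ℝ) (i : Fin k) (z : Fin k → ℤˣ) :
    rademacherWeight τ z = (if z i = 1 then τ else 1 - τ) * weightErase τ i z := by
  rw [rademacherWeight, weightErase, Finset.mul_prod_erase _
    (fun j => if z j = 1 then τ else 1 - τ) (Finset.mem_univ i)]

theorem weightErase_flip (τ : ℝ) (i : Fin k) (z : Fin k → ℤˣ) :
    weightErase τ i (flip z i) = weightErase τ i z :=
  Finset.prod_congr rfl fun j hj => by rw [flip_apply_of_ne z (Finset.mem_erase.mp hj).1]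

theorem sum_rademacherWeight (τ : ℝ) : ∑ z : Fin k → ℤˣ, rademacherWeight τ z = 1 := by
  have h := Fintype.prod_sum (fun (_ : Fin k) (s : ℤˣ) => if s = 1 then τ else 1 - τ)
  rw [show (fun z : Fin k → ℤˣ => rademacherWeight τ z) =
    fun z => ∏ i, if z i = 1 then τ else 1 - τ from rfl, ← h]
  refine Finset.prod_eq_one fun i _ => ?_
  rw [UnitsInt.univ, Finset.sum_pair (by decide)]
  simp

theorem sum_filter_neg_one_eq {E : Type*} [AddCommMonoid E] (i : Fin k) (G : (Fin k → ℤˣ) → E) :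
    ∑ z : Fin k → ℤˣ with z i = -1, G z = ∑ z : Fin k → ℤˣ with z i = 1, G (flip z i) := by
  refine Finset.sum_nbij' (fun z => flip z i) (fun z => flip z i) ?_ ?_ ?_ ?_ ?_ <;>
    simp +contextual [flip_apply_self, flip_flip]

theorem sum_eq_sum_filter_add_flip {E : Type*} [AddCommMonoid E] (i : Fin k)
    (G : (Fin k → ℤˣ) → E) :
    ∑ z, G z = ∑ z : Fin k → ℤˣ with z i = 1, (G z + G (flip z i)) := by
  rw [Finset.sum_add_distrib, ← sum_filter_neg_one_eq, ← Finset.sum_filter_add_sum_filter_not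
    Finset.univ (fun z : Fin k → ℤˣ => z i = 1)]
  congr 2
  ext z
  rcases Int.units_eq_one_or (z i) with h | h <;> simp [h]

theorem sum_filter_weightErase (τ : ℝ) (i : Fin k) :
    ∑ z : Fin k → ℤˣ with z i = 1, weightErase τ i z = 1 := by
  rw [← sum_rademacherWeight (k := k) τ, sum_eq_sum_filter_add_flip i]
  refine Finset.sum_congr rfl fun z hz => ?_
  rw [rademacherWeight_eq τ i, rademacherWeight_eq τ i, weightErase_flip, flip_apply_self,
    (Finset.mem_filter.mp hz).2]
  simp
  ring

theorem weightErase_nonneg {τ : ℝ} (h0 : 0 < τ) (h1 : τ < 1) (i : Fin k) (z : Fin k → ℤˣ) :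
    0 ≤ weightErase τ i z :=
  Finset.prod_nonneg fun j _ => by split_ifs <;> linarith

theorem rademacherWeight_pos {τ : ℝ} (h0 : 0 < τ) (h1 : τ < 1) (z : Fin k → ℤˣ) :
    0 < rademacherWeight τ z :=
  Finset.prod_pos fun j _ => by split_ifs <;> linarith

theorem rademacherWeight_div_eq {τ : ℝ} (h0 : 0 < τ) (h1 : τ < 1) (i : Fin k) (s : ℤˣ)
    (z : Fin k → ℤˣ) (hz : z i = s) :
    rademacherWeight τ z / ∑ z' : Fin k → ℤˣ with z' i = s, rademacherWeight τ z' =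
      weightErase τ i z := by
  have hs : (if s = 1 then τ else 1 - τ) ≠ 0 := by
    split_ifs
    · exact h0.ne'
    · linarith
  have hsum : ∑ z' : Fin k → ℤˣ with z' i = s, weightErase τ i z' = 1 := by
    rcases Int.units_eq_one_or s with rfl | rfl
    · exact sum_filter_weightErase τ i
    · rw [sum_filter_neg_one_eq]
      simp only [weightErase_flip]
      exact sum_filter_weightErase τ i
  have h : ∑ z' : Fin k → ℤˣ with z' i = s, rademacherWeight τ z' =
      if s = 1 then τ else 1 - τ := by
    rw [Finset.sum_congr rfl fun z' hz' => by
      rw [rademacherWeight_eq τ i, (Finset.mem_filter.mp hz').2], ← Finset.mul_sum, hsum, mul_one]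
  rw [h, rademacherWeight_eq τ i, hz, mul_div_cancel_left₀ _ hs]

theorem condMixture_real_apply {Ω : Type*} [MeasurableSpace Ω] {τ : ℝ} (h0 : 0 < τ) (h1 : τ < 1)
    (L : (Fin k → ℤˣ) → Measure Ω) [∀ z, IsFiniteMeasure (L z)] (i : Fin k) (s : ℤˣ) (A : Set Ω) :
    (condMixture τ L i s).real A =
      ∑ z : Fin k → ℤˣ with z i = s, weightErase τ i z * (L z).real A := by
  rw [condMixture, measureReal_def, Measure.finsetSum_apply, ENNReal.toReal_sum]
  · refine Finset.sum_congr rfl fun z hz => ?_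
    rw [rademacherWeight_div_eq h0 h1 i s z (Finset.mem_filter.mp hz).2, Measure.smul_apply,
      smul_eq_mul, ENNReal.toReal_mul, ENNReal.toReal_ofReal (weightErase_nonneg h0 h1 i z),
      measureReal_def]
  · intro z _
    rw [Measure.smul_apply, smul_eq_mul]
    exact ENNReal.mul_ne_top ENNReal.ofReal_ne_top (measure_ne_top _ _)

/-- The discrepancy in coordinate `i` is at most the mean distance between neighbours: `Z` and its
flip have the same conditional law of the remaining coordinates. -/
theorem tvDist_condMixture_le {Ω : Type*} [MeasurableSpace Ω] {τ : ℝ} (h0 : 0 < τ) (h1 : τ < 1)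
    (L : (Fin k → ℤˣ) → Measure Ω) [∀ z, IsFiniteMeasure (L z)] (i : Fin k) :
    tvDist (condMixture τ L i 1) (condMixture τ L i (-1)) ≤
      ∑ z, rademacherWeight τ z * tvDist (L z) (L (flip z i)) := by
  refine tvDist_le fun A hA => ?_
  rw [condMixture_real_apply h0 h1, condMixture_real_apply h0 h1, sum_filter_neg_one_eq,
    ← Finset.sum_sub_distrib, sum_eq_sum_filter_add_flip i]
  refine (Finset.abs_sum_le_sum_abs _ _).trans (Finset.sum_le_sum fun z hz => ?_)
  rw [rademacherWeight_eq τ i, rademacherWeight_eq τ i, weightErase_flip, flip_apply_self,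
    flip_flip, (Finset.mem_filter.mp hz).2, ← mul_sub, abs_mul,
    abs_of_nonneg (weightErase_nonneg h0 h1 i z), tvDist_comm (L (flip z i))]
  have h := mul_le_mul_of_nonneg_left (abs_measureReal_sub_le_tvDist (L z) (L (flip z i)) hA)
    (weightErase_nonneg h0 h1 i z)
  simp
  linarith

theorem exists_averageDiscrepancy_sq_le {Ω : Type*} [MeasurableSpace Ω] {τ : ℝ} (h0 : 0 < τ)
    (h1 : τ < 1) (L : (Fin k → ℤˣ) → Measure Ω) [∀ z, IsFiniteMeasure (L z)] :
    ∃ z, averageDiscrepancy τ L ^ 2 ≤ 1 / (k : ℝ) * ∑ i, tvDist (L z) (L (flip z i)) ^ 2 := by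
  by_contra! hcon
  set T : (Fin k → ℤˣ) → Fin k → ℝ := fun z i => tvDist (L z) (L (flip z i))
  set M : (Fin k → ℤˣ) → ℝ := fun z => 1 / (k : ℝ) * ∑ i, T z i
  have hle : averageDiscrepancy τ L ≤ ∑ z, rademacherWeight τ z * M z := by
    have : ∑ z, rademacherWeight τ z * M z =
        1 / (k : ℝ) * ∑ i, ∑ z, rademacherWeight τ z * T z i := by
      rw [Finset.sum_comm, Finset.mul_sum]
      refine Finset.sum_congr rfl fun z _ => ?_
      rw [← Finset.mul_sum]
      ring
    rw [this, averageDiscrepancy]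
    exact mul_le_mul_of_nonneg_left (Finset.sum_le_sum fun i _ => tvDist_condMixture_le h0 h1 L i)
      (by positivity)
  have hnn : 0 ≤ averageDiscrepancy τ L :=
    mul_nonneg (by positivity) (Finset.sum_nonneg fun i _ => tvDist_nonneg _ _)
  have hM : ∀ z, M z ^ 2 ≤ 1 / (k : ℝ) * ∑ i, T z i ^ 2 := by
    intro z
    rcases Nat.eq_zero_or_pos k with hk | hk
    · subst hk; simp [M]
    have hk' : (0 : ℝ) < k := by exact_mod_cast hk
    have := sq_sum_le_card_mul_sum_sq (s := (Finset.univ : Finset (Fin k))) (f := T z)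
    rw [Finset.card_univ, Fintype.card_fin] at this
    calc M z ^ 2 = (1 / (k : ℝ)) ^ 2 * (∑ i, T z i) ^ 2 := by simp only [M]; ring
      _ ≤ (1 / (k : ℝ)) ^ 2 * (k * ∑ i, T z i ^ 2) := by gcongr
      _ = 1 / (k : ℝ) * ∑ i, T z i ^ 2 := by field_simp
  have hlt : ∑ z, rademacherWeight τ z * M z <
      ∑ z : Fin k → ℤˣ, rademacherWeight τ z * averageDiscrepancy τ L :=
    Finset.sum_lt_sum_of_nonempty Finset.univ_nonempty fun z _ =>
      mul_lt_mul_of_pos_left (lt_of_pow_lt_pow_left₀ 2 hnn ((hM z).trans_lt (hcon z)))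
        (rademacherWeight_pos h0 h1 z)
  rw [← Finset.sum_mul, sum_rademacherWeight, one_mul] at hlt
  exact absurd hle hlt.not_ge

end Mixtures

/-! ### Hellinger distance of densities -/

section Hellinger

variable {Ω : Type*} [MeasurableSpace Ω] {m : Measure Ω}

/-- The squared Hellinger distance `∫ (√f - √g)² dm` of two densities (without the factor `1/2`). -/
def hellinger (m : Measure Ω) (f g : Ω → ℝ≥0∞) : ℝ≥0∞ :=
  ∫⁻ ω, ENNReal.ofReal ((√(f ω).toReal - √(g ω).toReal) ^ 2) ∂m

theorem ofReal_sq_sub_add {a b : ℝ≥0∞} (ha : a ≠ ∞) (hb : b ≠ ∞) :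
    ENNReal.ofReal ((√a.toReal - √b.toReal) ^ 2) + 2 * ENNReal.ofReal √(a * b).toReal = a + b := by
  rw [ENNReal.toReal_mul, Real.sqrt_mul ENNReal.toReal_nonneg,
    show (2 : ℝ≥0∞) = ENNReal.ofReal 2 by simp, ← ENNReal.ofReal_mul (by norm_num),
    ← ENNReal.ofReal_add (by positivity) (by positivity)]
  conv_rhs => rw [← ENNReal.ofReal_toReal ha, ← ENNReal.ofReal_toReal hb,
    ← ENNReal.ofReal_add (by positivity) (by positivity)]
  congr 1
  have h1 := Real.sq_sqrt (ENNReal.toReal_nonneg (a := a))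
  have h2 := Real.sq_sqrt (ENNReal.toReal_nonneg (a := b))
  linear_combination h1 + h2

theorem hellinger_add_affinity {f g : Ω → ℝ≥0∞} (hf : Measurable f) (hg : Measurable g)
    (hf1 : ∫⁻ ω, f ω ∂m ≠ ∞) (hg1 : ∫⁻ ω, g ω ∂m ≠ ∞) :
    hellinger m f g + 2 * ∫⁻ ω, ENNReal.ofReal √(f ω * g ω).toReal ∂m =
      ∫⁻ ω, f ω ∂m + ∫⁻ ω, g ω ∂m := by
  rw [hellinger, ← lintegral_const_mul _ (by fun_prop), ← lintegral_add_left (by fun_prop),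
    ← lintegral_add_left hf]
  refine lintegral_congr_ae ?_
  filter_upwards [ae_lt_top hf hf1, ae_lt_top hg hg1] with ω h1 h2
  exact ofReal_sq_sub_add h1.ne h2.ne

theorem hellinger_le_two {f g : Ω → ℝ≥0∞} (hf : Measurable f) (hg : Measurable g)
    (hf1 : ∫⁻ ω, f ω ∂m = 1) (hg1 : ∫⁻ ω, g ω ∂m = 1) : hellinger m f g ≤ 2 := by
  have h := hellinger_add_affinity (m := m) hf hg (by simp [hf1]) (by simp [hg1])
  rw [hf1, hg1, one_add_one_eq_two] at h
  exact h ▸ le_self_add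

/-- The cut-and-paste property: the Hellinger distance of two probability densities depends only on
their product. -/
theorem hellinger_congr_of_mul_eq {f g f' g' : Ω → ℝ≥0∞} (hf : Measurable f) (hg : Measurable g)
    (hf' : Measurable f') (hg' : Measurable g')
    (hf1 : ∫⁻ ω, f ω ∂m = 1) (hg1 : ∫⁻ ω, g ω ∂m = 1)
    (hf1' : ∫⁻ ω, f' ω ∂m = 1) (hg1' : ∫⁻ ω, g' ω ∂m = 1)
    (h : ∀ ω, f ω * g ω = f' ω * g' ω) : hellinger m f g = hellinger m f' g' := by
  have e := hellinger_add_affinity (m := m) hf hg (by simp [hf1]) (by simp [hg1])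
  have e' := hellinger_add_affinity (m := m) hf' hg' (by simp [hf1']) (by simp [hg1'])
  simp only [h] at e
  rw [hf1, hg1] at e
  rw [hf1', hg1'] at e'
  refine (ENNReal.add_left_inj (ne_top_of_le_ne_top (b := 1 + 1) (by simp) ?_)).mp
    (e.trans e'.symm)
  rw [← e']
  exact le_add_self

open Finset in
theorem sum_sum_sq_sub_le {κ : Type*} (t : Finset κ) (x : κ → ℝ) (c : ℝ) :
    ∑ a ∈ t, ∑ b ∈ t, (x a - x b) ^ 2 ≤ 2 * #t * ∑ a ∈ t, (x a - c) ^ 2 := by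
  have h : ∀ a b, (x a - x b) ^ 2 = (x a - c) ^ 2 + (x b - c) ^ 2 - 2 * ((x a - c) * (x b - c)) :=
    fun a b => by ring
  simp only [h, sum_sub_distrib, sum_add_distrib, sum_const, nsmul_eq_mul, ← mul_sum, ← sum_mul]
  nlinarith [sq_nonneg (∑ a ∈ t, (x a - c))]

open Finset in
theorem sum_sum_hellinger_le {κ : Type*} (t : Finset κ) {f : κ → Ω → ℝ≥0∞}
    (hf : ∀ a, Measurable (f a)) {g : Ω → ℝ≥0∞} (hg : Measurable g) :
    ∑ a ∈ t, ∑ b ∈ t, hellinger m (f a) (f b) ≤ 2 * #t * ∑ a ∈ t, hellinger m (f a) g := by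
  have hm : ∀ a, Measurable fun ω => √(f a ω).toReal := fun a => by have := hf a; fun_prop
  have hm' : Measurable fun ω => √(g ω).toReal := by fun_prop
  have h2 : ∀ a b, Measurable fun ω => ENNReal.ofReal ((√(f a ω).toReal - √(f b ω).toReal) ^ 2) :=
    fun a b => (((hm a).sub (hm b)).pow_const 2).ennreal_ofReal
  have h3 : ∀ a, Measurable fun ω => ENNReal.ofReal ((√(f a ω).toReal - √(g ω).toReal) ^ 2) :=
    fun a => (((hm a).sub hm').pow_const 2).ennreal_ofReal
  simp only [hellinger]
  rw [sum_congr rfl fun a _ => (lintegral_finsetSum t fun b _ => h2 a b).symm,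
    ← lintegral_finsetSum t fun a _ => Finset.measurable_sum t fun b _ => h2 a b,
    ← lintegral_finsetSum t fun a _ => h3 a,
    ← lintegral_const_mul _ (Finset.measurable_sum t fun a _ => h3 a)]
  refine lintegral_mono fun ω => ?_
  rw [show (2 : ℝ≥0∞) * #t = ENNReal.ofReal (2 * #t) by
    rw [ENNReal.ofReal_mul (by norm_num)]; simp]
  rw [sum_congr rfl fun a _ => (ENNReal.ofReal_sum_of_nonneg fun b _ => by positivity).symm,
    ← ENNReal.ofReal_sum_of_nonneg fun a _ => by positivity,
    ← ENNReal.ofReal_sum_of_nonneg fun a _ => by positivity,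
    ← ENNReal.ofReal_mul (by positivity)]
  exact ENNReal.ofReal_le_ofReal (sum_sum_sq_sub_le t _ _)

theorem hellinger_self (f : Ω → ℝ≥0∞) : hellinger m f f = 0 := by simp [hellinger]

open Finset in
/-- If the probability densities `f_S` satisfy `f_A f_B = f_{A ∪ B} f_∅` for disjoint `A, B`, then
changing all indices costs at most six times the total cost of changing a single one. -/
theorem hellinger_le_six_mul_sum {ι : Type*} [Fintype ι] [DecidableEq ι]
    (f : Finset ι → Ω → ℝ≥0∞) (hf : ∀ S, Measurable (f S)) (h1 : ∀ S, ∫⁻ ω, f S ω ∂m = 1)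
    (hmul : ∀ A B, Disjoint A B → ∀ ω, f A ω * f B ω = f (A ∪ B) ω * f ∅ ω) :
    hellinger m (f univ) (f ∅) ≤ 6 * ∑ j, hellinger m (f {j}) (f ∅) := by
  have hfin : ∀ S T, hellinger m (f S) (f T) ≠ ∞ := fun S T =>
    ne_top_of_le_ne_top (by simp) (hellinger_le_two (hf S) (hf T) (h1 S) (h1 T))
  have key := apply_univ_le_six_mul_sum (fun S => (hellinger m (f S) (f ∅)).toReal)
    (fun _ => ENNReal.toReal_nonneg) (by simp [hellinger_self]) (by
      intro t A hA
      have e : ∀ a ∈ t, ∑ b ∈ t.erase a, (hellinger m (f (A a ∪ A b)) (f ∅)).toReal =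
          ∑ b ∈ t, (hellinger m (f (A a)) (f (A b))).toReal := by
        intro a ha
        rw [← add_sum_erase t _ ha, hellinger_self, ENNReal.toReal_zero, zero_add]
        refine sum_congr rfl fun b hb => ?_
        congr 1
        exact (hellinger_congr_of_mul_eq (hf _) (hf _) (hf _) (hf _) (h1 _) (h1 _) (h1 _) (h1 _)
          (hmul _ _ (hA ha (mem_of_mem_erase hb) (ne_of_mem_erase hb).symm))).symm
      rw [sum_congr rfl e]
      have h := sum_sum_hellinger_le (m := m) t (fun a => hf (A a)) (hf ∅)
      have h' := ENNReal.toReal_mono (ENNReal.mul_ne_top (by simp [ENNReal.mul_eq_top])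
        (ENNReal.sum_ne_top.mpr fun a _ => hfin _ _)) h
      rw [ENNReal.toReal_sum fun a _ => ENNReal.sum_ne_top.mpr fun b _ => hfin _ _,
        ENNReal.toReal_mul, ENNReal.toReal_sum fun a _ => hfin _ _] at h'
      rw [sum_congr rfl fun a _ => ENNReal.toReal_sum fun b _ => hfin _ _] at h'
      simpa using h')
  have hs : ∑ j, hellinger m (f {j}) (f ∅) ≠ ∞ := ENNReal.sum_ne_top.mpr fun _ _ => hfin _ _
  rw [← ENNReal.toReal_le_toReal (hfin _ _) (ENNReal.mul_ne_top (by simp) hs), ENNReal.toReal_mul,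
    ENNReal.toReal_sum fun _ _ => hfin _ _]
  simpa using key

/-- Le Cam's inequality `d_TV² ≤ ∫ (√f - √g)²`. -/
theorem tvDist_sq_le_hellinger {f g : Ω → ℝ≥0∞} (hf : Measurable f) (hg : Measurable g)
    (hf1 : ∫⁻ ω, f ω ∂m = 1) (hg1 : ∫⁻ ω, g ω ∂m = 1) :
    ENNReal.ofReal (tvDist (m.withDensity f) (m.withDensity g) ^ 2) ≤ hellinger m f g := by
  have hH := ne_top_of_le_ne_top (by simp) (hellinger_le_two hf hg hf1 hg1)
  have hfF : ∀ᵐ ω ∂m, f ω < ∞ := ae_lt_top hf (by simp [hf1])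
  have hgF : ∀ᵐ ω ∂m, g ω < ∞ := ae_lt_top hg (by simp [hg1])
  have hF : Integrable (fun ω => (f ω).toReal) m :=
    integrable_toReal_of_lintegral_ne_top hf.aemeasurable (by simp [hf1])
  have hG : Integrable (fun ω => (g ω).toReal) m :=
    integrable_toReal_of_lintegral_ne_top hg.aemeasurable (by simp [hg1])
  have hF1 : ∫ ω, (f ω).toReal ∂m = 1 := by
    rw [integral_toReal hf.aemeasurable hfF, hf1, ENNReal.toReal_one]
  have hG1 : ∫ ω, (g ω).toReal ∂m = 1 := by
    rw [integral_toReal hg.aemeasurable hgF, hg1, ENNReal.toReal_one]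
  have hDi : Integrable (fun ω => (√(f ω).toReal - √(g ω).toReal) ^ 2) m := by
    refine ⟨by fun_prop, ?_⟩
    rw [hasFiniteIntegral_iff_ofReal (.of_forall fun ω => sq_nonneg _)]
    exact hH.lt_top
  set H := ∫ ω, (√(f ω).toReal - √(g ω).toReal) ^ 2 ∂m with hHdef
  have hHe : hellinger m f g = ENNReal.ofReal H := by
    rw [hHdef, ofReal_integral_eq_lintegral_ofReal hDi (.of_forall fun ω => sq_nonneg _)]
    rfl
  set V := ∫ ω, |(f ω).toReal - (g ω).toReal| ∂m with hV
  have hFGi : Integrable (fun ω => |(f ω).toReal - (g ω).toReal|) m := (hF.sub hG).abs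
  -- The Cauchy-Schwarz inequality for `|f - g| = |√f - √g| (√f + √g)`, by a discriminant.
  have hquad : ∀ s : ℝ, 0 ≤ H * (s * s) + (-2 * V) * s + 4 := by
    intro s
    have hle : ∫ ω, 2 * s * |(f ω).toReal - (g ω).toReal| ∂m ≤
        ∫ ω, (s ^ 2 * (√(f ω).toReal - √(g ω).toReal) ^ 2 +
          (2 * (f ω).toReal + 2 * (g ω).toReal)) ∂m := by
      refine integral_mono (hFGi.const_mul _)
        ((hDi.const_mul _).add ((hF.const_mul _).add (hG.const_mul _))) fun ω => ?_
      have e1 := Real.sq_sqrt (ENNReal.toReal_nonneg (a := f ω))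
      have e2 := Real.sq_sqrt (ENNReal.toReal_nonneg (a := g ω))
      have p1 := Real.sqrt_nonneg (f ω).toReal
      have p2 := Real.sqrt_nonneg (g ω).toReal
      set x := √(f ω).toReal
      set y := √(g ω).toReal
      have : |(f ω).toReal - (g ω).toReal| = |x - y| * (x + y) := by
        rw [← e1, ← e2, sq_sub_sq, abs_mul, abs_of_nonneg (add_nonneg p1 p2), mul_comm]
      change 2 * s * |(f ω).toReal - (g ω).toReal| ≤
        s ^ 2 * (x - y) ^ 2 + (2 * (f ω).toReal + 2 * (g ω).toReal)
      rw [this, ← e1, ← e2]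
      have e3 := sq_abs (x - y)
      nlinarith [sq_nonneg (s * |x - y| - (x + y)), sq_nonneg (x - y)]
    have hFG2 : Integrable (fun ω => 2 * (f ω).toReal + 2 * (g ω).toReal) m :=
      (hF.const_mul _).add (hG.const_mul _)
    rw [integral_const_mul, integral_add (hDi.const_mul _) hFG2, integral_const_mul,
      integral_add (hF.const_mul _) (hG.const_mul _), integral_const_mul, integral_const_mul,
      hF1, hG1] at hle
    nlinarith
  have hVH : V ^ 2 ≤ 4 * H := by
    have := discrim_le_zero hquad
    rw [discrim] at this
    nlinarith
  rw [hHe]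
  refine ENNReal.ofReal_le_ofReal ?_
  have hreal : ∀ (h : Ω → ℝ≥0∞), Measurable h → (∫⁻ ω, h ω ∂m = 1) → ∀ A, MeasurableSet A →
      (m.withDensity h).real A = ∫ ω in A, (h ω).toReal ∂m := by
    intro h hh hh1 A hA
    rw [measureReal_def, withDensity_apply _ hA, integral_toReal hh.aemeasurable
      (ae_restrict_of_ae (ae_lt_top hh (by simp [hh1])))]
  have hTV : tvDist (m.withDensity f) (m.withDensity g) ≤ V / 2 := by
    refine tvDist_le fun A hA => ?_
    rw [hreal f hf hf1 A hA, hreal g hg hg1 A hA, ← integral_sub hF.integrableOn hG.integrableOn]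
    have hsum := integral_add_compl hA (hF.sub hG)
    have hsum' := integral_add_compl hA hFGi
    simp only [Pi.sub_apply] at hsum
    rw [integral_sub hF hG, hF1, hG1, sub_self] at hsum
    have b1 := abs_integral_le_integral_abs (μ := m.restrict A)
      (f := fun ω => (f ω).toReal - (g ω).toReal)
    have b2 := abs_integral_le_integral_abs (μ := m.restrict Aᶜ)
      (f := fun ω => (f ω).toReal - (g ω).toReal)
    rw [eq_neg_of_add_eq_zero_right hsum, abs_neg] at b2
    linarith
  have := pow_le_pow_left₀ (tvDist_nonneg _ _) hTV 2
  nlinarith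

/-- The squared Hellinger distance is at most the chi-square divergence, pointwise. For `a = 0 < b`
the right-hand side is `∞`. -/
theorem ofReal_sq_sqrt_sub_le {a b : ℝ≥0∞} (ha : a ≠ ∞) :
    ENNReal.ofReal ((√b.toReal - √a.toReal) ^ 2) ≤
      ENNReal.ofReal ((b.toReal - a.toReal) ^ 2) / a := by
  rcases eq_or_ne a 0 with rfl | h0
  · by_cases hb : b.toReal = 0
    · simp [hb]
    · have : ENNReal.ofReal ((b.toReal - (0 : ℝ≥0∞).toReal) ^ 2) ≠ 0 := by
        simp only [ENNReal.toReal_zero, sub_zero, ne_eq, ENNReal.ofReal_eq_zero, not_le]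
        positivity
      rw [ENNReal.div_zero this]
      exact le_top
  · rw [ENNReal.le_div_iff_mul_le (.inl h0) (.inl ha)]
    conv_lhs => arg 2; rw [← ENNReal.ofReal_toReal ha]
    rw [← ENNReal.ofReal_mul (sq_nonneg _)]
    refine ENNReal.ofReal_le_ofReal ?_
    have e1 := Real.sq_sqrt (ENNReal.toReal_nonneg (a := a))
    have e2 := Real.sq_sqrt (ENNReal.toReal_nonneg (a := b))
    have p1 := Real.sqrt_nonneg a.toReal
    have p2 := Real.sqrt_nonneg b.toReal
    set x := √a.toReal
    set y := √b.toReal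
    rw [← e1, ← e2, show (y ^ 2 - x ^ 2) ^ 2 = (y - x) ^ 2 * (y + x) ^ 2 by ring]
    exact mul_le_mul_of_nonneg_left (pow_le_pow_left₀ p1 (le_add_of_nonneg_left p2) 2) (sq_nonneg _)

end Hellinger

/-! ### Product measures -/

section Pi

theorem lintegral_pi_prod {n : ℕ} {X : Type*} [MeasurableSpace X] (ν : Fin n → Measure X)
    [∀ i, IsProbabilityMeasure (ν i)] {f : Fin n → X → ℝ≥0∞} (hf : ∀ i, Measurable (f i)) :
    ∫⁻ x, ∏ i, f i (x i) ∂(Measure.pi ν) = ∏ i, ∫⁻ x, f i x ∂(ν i) := by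
  have h := lintegral_prod_eq_prod_lintegral_of_indepFun (μ := Measure.pi ν) Finset.univ
    (fun i x => f i (x i)) (iIndepFun_pi fun i => (hf i).aemeasurable)
    fun i => (hf i).comp (measurable_pi_apply i)
  rw [h]
  refine Finset.prod_congr rfl fun i _ => ?_
  rw [← (measurePreserving_eval ν i).lintegral_comp (hf i)]

theorem absolutelyContinuous_pi {n : ℕ} {X : Type*} [MeasurableSpace X] (ν ν' : Fin n → Measure X)
    [∀ i, IsProbabilityMeasure (ν i)] [∀ i, IsProbabilityMeasure (ν' i)] (h : ∀ i, ν' i ≪ ν i) :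
    Measure.pi ν' ≪ Measure.pi ν := by
  have : Measure.pi ν' = (Measure.pi ν).withDensity
      fun x => ∏ i, (ν' i).rnDeriv (ν i) (x i) := by
    refine Measure.pi_eq fun s hs => ?_
    rw [withDensity_apply _ (.univ_pi hs), ← lintegral_indicator (.univ_pi hs)]
    have e : (Set.univ.pi s).indicator (fun x => ∏ i, (ν' i).rnDeriv (ν i) (x i)) =
        fun x => ∏ i, (s i).indicator ((ν' i).rnDeriv (ν i)) (x i) := by
      ext x
      by_cases hx : x ∈ Set.univ.pi s
      · rw [Set.indicator_of_mem hx]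
        exact Finset.prod_congr rfl fun i _ =>
          (Set.indicator_of_mem (hx i (Set.mem_univ i)) _).symm
      · rw [Set.indicator_of_notMem hx]
        simp only [Set.mem_pi, Set.mem_univ, true_imp_iff, not_forall] at hx
        obtain ⟨i, hi⟩ := hx
        exact (Finset.prod_eq_zero (Finset.mem_univ i) (Set.indicator_of_notMem hi _)).symm
    rw [e, lintegral_pi_prod ν fun i => (Measure.measurable_rnDeriv _ _).indicator (hs i)]
    refine Finset.prod_congr rfl fun i _ => ?_
    rw [lintegral_indicator (hs i), Measure.setLIntegral_rnDeriv (h i)]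
  rw [this]
  exact withDensity_absolutelyContinuous _ _

end Pi

/-! ### The space of message sequences -/

section Messages

variable {𝒴 : Type*} [MeasurableSpace 𝒴]

theorem measurableEmbedding_messagesMk (m : ℕ) :
    MeasurableEmbedding fun h : Fin m → 𝒴 => (⟨m, h⟩ : Messages 𝒴) where
  injective := sigma_mk_injective (β := fun m : ℕ => Fin m → 𝒴)
  measurable := by
    intro s hs
    exact MeasurableSpace.measurableSet_iInf.mp hs m
  measurableSet_image' := by
    intro s hs
    refine MeasurableSpace.measurableSet_iInf.mpr fun m' => ?_
    change MeasurableSet ((fun h : Fin m' → 𝒴 => (⟨m', h⟩ : Messages 𝒴)) ⁻¹'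
      ((fun h : Fin m → 𝒴 => (⟨m, h⟩ : Messages 𝒴)) '' s))
    by_cases h : m' = m
    · subst h
      rwa [Set.preimage_image_eq _ (sigma_mk_injective (β := fun m : ℕ => Fin m → 𝒴))]
    · convert MeasurableSet.empty
      ext x
      simp only [Set.mem_preimage, Set.mem_image, Sigma.mk.injEq, Set.mem_empty_iff_false,
        iff_false, not_exists, not_and]
      exact fun _ _ e => (h e.symm).elim

theorem measurable_messages_prod {X E : Type*} [MeasurableSpace X] [MeasurableSpace E]
    {F : Messages 𝒴 × X → E}
    (hF : ∀ m : ℕ, Measurable fun q : (Fin m → 𝒴) × X => F (⟨m, q.1⟩, q.2)) : Measurable F := by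
  intro s hs
  have : F ⁻¹' s = ⋃ m : ℕ, Prod.map (fun h : Fin m → 𝒴 => (⟨m, h⟩ : Messages 𝒴)) id ''
      ((fun q : (Fin m → 𝒴) × X => F (⟨m, q.1⟩, q.2)) ⁻¹' s) := by
    ext ⟨⟨m, h⟩, x⟩
    simp only [Set.mem_preimage, Set.mem_iUnion, Set.mem_image, Prod.exists, Prod.map, id]
    constructor
    · intro hx
      exact ⟨m, h, x, hx, rfl⟩
    · rintro ⟨m', h', x', hx, e⟩
      rw [← e]
      exact hx
  rw [this]
  exact .iUnion fun m =>
    ((measurableEmbedding_messagesMk m).prodMap .id).measurableSet_image' (hF m hs)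

instance (μ : Measure 𝒴) [SigmaFinite μ] : SFinite (messagesMeasure μ) := by
  unfold messagesMeasure; infer_instance

theorem lintegral_messagesMeasure (μ : Measure 𝒴) (f : Messages 𝒴 → ℝ≥0∞) :
    ∫⁻ y, f y ∂(messagesMeasure μ) =
      ∑' m : ℕ, ∫⁻ h : Fin m → 𝒴, f ⟨m, h⟩ ∂(Measure.pi fun _ => μ) := by
  rw [messagesMeasure, lintegral_sum_measure]
  exact tsum_congr fun m => (measurableEmbedding_messagesMk m).lintegral_map _

end Messages

theorem measurable_take {𝒴 : Type*} [MeasurableSpace 𝒴] {m s : ℕ} (hs : s ≤ m) :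
    Measurable fun h : Fin m → 𝒴 => Fin.take s hs h :=
  measurable_pi_lambda _ fun _ => measurable_pi_apply _

theorem lintegral_pi_snoc {𝒴 : Type*} [MeasurableSpace 𝒴] (μ : Measure 𝒴) [SigmaFinite μ] (t : ℕ)
    {F : (Fin (t + 1) → 𝒴) → ℝ≥0∞} (hF : Measurable F) :
    ∫⁻ h, F h ∂(Measure.pi fun _ => μ) =
      ∫⁻ h : Fin t → 𝒴, ∫⁻ y, F (Fin.snoc (α := fun _ => 𝒴) h y) ∂μ ∂(Measure.pi fun _ => μ) := by
  have h := (measurePreserving_piFinSuccAbove (fun _ : Fin (t + 1) => μ) (Fin.last t)).symm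
  have hF' : Measurable fun q => F ((MeasurableEquiv.piFinSuccAbove (fun _ => 𝒴)
    (Fin.last t)).symm q) := hF.comp h.measurable
  rw [← h.lintegral_comp hF, lintegral_prod_symm _ hF'.aemeasurable]
  refine lintegral_congr fun g => lintegral_congr fun y => ?_
  simp [MeasurableEquiv.piFinSuccAbove, Fin.insertNthEquiv, Fin.insertNth_last']

theorem measurable_snoc {𝒴 : Type*} [MeasurableSpace 𝒴] (t : ℕ) :
    Measurable fun q : (Fin t → 𝒴) × 𝒴 => Fin.snoc (α := fun _ => 𝒴) q.1 q.2 := by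
  refine measurable_pi_lambda _ fun i => ?_
  refine Fin.lastCases ?_ (fun i => ?_) i
  · simpa using measurable_snd
  · simp only [Fin.snoc_castSucc]
    exact (measurable_pi_apply i).comp measurable_fst

/-! ### Densities of messages and transcripts -/

namespace Protocol

variable {n : ℕ} {𝒰 𝒳 𝒴 : Type*} [MeasurableSpace 𝒰] [MeasurableSpace 𝒳] [MeasurableSpace 𝒴]
  {μ : Measure 𝒴}

/-- The density of the message of round `t`, given the public randomness, the inputs and the
history; it vanishes if the protocol has stopped. -/
def roundDensity (π : Protocol n 𝒰 𝒳 𝒴 μ) (t : ℕ) (u : 𝒰) (x : Fin n → 𝒳) (h : Fin t → 𝒴)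
    (y : 𝒴) : ℝ≥0∞ :=
  match π.speaker t u h with
  | none => 0
  | some j => π.density t u h (x j) y

theorem measurable_roundDensity (π : Protocol n 𝒰 𝒳 𝒴 μ) (t : ℕ) :
    Measurable fun q : ((𝒰 × (Fin n → 𝒳)) × (Fin t → 𝒴)) × 𝒴 =>
      π.roundDensity t q.1.1.1 q.1.1.2 q.1.2 q.2 := by
  have e : (fun q : ((𝒰 × (Fin n → 𝒳)) × (Fin t → 𝒴)) × 𝒴 =>
      π.roundDensity t q.1.1.1 q.1.1.2 q.1.2 q.2) = fun q => ∑ j : Fin n,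
      {q : ((𝒰 × (Fin n → 𝒳)) × (Fin t → 𝒴)) × 𝒴 |
        π.speaker t q.1.1.1 q.1.2 = some j}.indicator
        (fun q => π.density t q.1.1.1 q.1.2 (q.1.1.2 j) q.2) q := by
    ext q
    simp only [roundDensity, Set.indicator_apply, Set.mem_ofPred_eq]
    obtain ⟨o, ho⟩ : ∃ o, π.speaker t q.1.1.1 q.1.2 = o := ⟨_, rfl⟩
    simp only [ho]
    cases o <;> simp
  rw [e]
  refine Finset.measurable_sum _ fun j _ => Measurable.indicator ?_ ?_
  · exact (π.measurable_density t).comp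
      (g := fun q => π.density t q.1 q.2.1 q.2.2.1 q.2.2.2)
      (f := fun q : ((𝒰 × (Fin n → 𝒳)) × (Fin t → 𝒴)) × 𝒴 =>
        (q.1.1.1, q.1.2, q.1.1.2 j, q.2)) (by fun_prop)
  · exact (measurableSet_preimage (f := fun q : ((𝒰 × (Fin n → 𝒳)) × (Fin t → 𝒴)) × 𝒴 =>
      (q.1.1.1, q.1.2)) (by fun_prop) (π.measurableSet_speaker t (some j)))

/-- The density of the first `t` messages on the event that the protocol does not stop before. -/
def aliveDensity (π : Protocol n 𝒰 𝒳 𝒴 μ) (t : ℕ) (u : 𝒰) (x : Fin n → 𝒳) (h : Fin t → 𝒴) :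
    ℝ≥0∞ :=
  ∏ s : Fin t, π.roundDensity s u x (Fin.take s s.2.le h) (h s)

theorem measurable_aliveDensity (π : Protocol n 𝒰 𝒳 𝒴 μ) (t : ℕ) (u : 𝒰) (x : Fin n → 𝒳) :
    Measurable (π.aliveDensity t u x) := by
  refine Finset.measurable_prod _ fun s _ => ?_
  exact (π.measurable_roundDensity s).comp
    (g := fun q : ((𝒰 × (Fin n → 𝒳)) × (Fin s → 𝒴)) × 𝒴 =>
      π.roundDensity s q.1.1.1 q.1.1.2 q.1.2 q.2)
    (f := fun h : Fin t → 𝒴 => (((u, x), Fin.take s s.2.le h), h s))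
    (((measurable_const).prodMk (measurable_take _)).prodMk (measurable_pi_apply s))

theorem aliveDensity_snoc (π : Protocol n 𝒰 𝒳 𝒴 μ) (t : ℕ) (u : 𝒰) (x : Fin n → 𝒳)
    (h : Fin t → 𝒴) (y : 𝒴) :
    π.aliveDensity (t + 1) u x (Fin.snoc (α := fun _ => 𝒴) h y) =
      π.aliveDensity t u x h * π.roundDensity t u x h y := by
  rw [aliveDensity, Fin.prod_univ_castSucc]
  have e : ∀ (s : ℕ) (hs : s ≤ t) (hs' : s ≤ t + 1),
      Fin.take s hs' (Fin.snoc (α := fun _ => 𝒴) h y) = Fin.take s hs h := by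
    intro s hs hs'
    ext i
    simp only [Fin.take]
    exact Fin.snoc_castSucc (α := fun _ => 𝒴) y h (Fin.castLE hs i)
  congr 1
  · refine Finset.prod_congr rfl fun s _ => ?_
    rw [Fin.snoc_castSucc]
    exact congrArg (fun g => π.roundDensity s u x g (h s)) (e s s.2.le _)
  · rw [Fin.snoc_last]
    exact congrArg (fun g => π.roundDensity t u x g y) (e t le_rfl _)

theorem measurableSet_isComplete (π : Protocol n 𝒰 𝒳 𝒴 μ) (m : ℕ) :
    MeasurableSet {q : (Fin m → 𝒴) × (𝒰 × 𝒳) | π.IsComplete q.2.1 ⟨m, q.1⟩} := by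
  have h : ∀ (s : ℕ) (hs : s ≤ m) (o : Option (Fin n)),
      MeasurableSet {q : (Fin m → 𝒴) × (𝒰 × 𝒳) | π.speaker s q.2.1 (Fin.take s hs q.1) = o} :=
    fun s hs o => measurableSet_preimage (f := fun q : (Fin m → 𝒴) × (𝒰 × 𝒳) =>
      (q.2.1, Fin.take s hs q.1))
      (measurable_snd.fst.prodMk ((measurable_take hs).comp measurable_fst))
      (π.measurableSet_speaker s o)
  simp only [IsComplete, Set.ofPred_and, Set.ofPred_forall]
  exact (MeasurableSet.iInter fun t : Fin m => (h t t.2.le none).compl).inter (h m le_rfl none)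

theorem measurable_playerFactor (π : Protocol n 𝒰 𝒳 𝒴 μ) (j : Fin n) :
    Measurable fun q : Messages 𝒴 × (𝒰 × 𝒳) => π.playerFactor q.2.1 j q.1 q.2.2 := by
  refine measurable_messages_prod fun m => ?_
  refine Measurable.ite (π.measurableSet_isComplete m) ?_ measurable_const
  change Measurable fun q : (Fin m → 𝒴) × (𝒰 × 𝒳) => ∏ t : Fin m,
    if π.speaker t q.2.1 (Fin.take t t.2.le q.1) = some j then
      π.density t q.2.1 (Fin.take t t.2.le q.1) q.2.2 (q.1 t) else 1
  refine Finset.measurable_prod _ fun t _ => Measurable.ite ?_ ?_ measurable_const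
  · exact measurableSet_preimage (f := fun q : (Fin m → 𝒴) × (𝒰 × 𝒳) =>
      (q.2.1, Fin.take t t.2.le q.1))
      (measurable_snd.fst.prodMk ((measurable_take t.2.le).comp measurable_fst))
      (π.measurableSet_speaker t (some j))
  · exact (π.measurable_density t).comp
      (g := fun q => π.density t q.1 q.2.1 q.2.2.1 q.2.2.2)
      (f := fun q : (Fin m → 𝒴) × (𝒰 × 𝒳) => (q.2.1, Fin.take t t.2.le q.1, q.2.2, q.1 t))
      (measurable_snd.fst.prodMk (((measurable_take t.2.le).comp measurable_fst).prodMk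
        (measurable_snd.snd.prodMk ((measurable_pi_apply t).comp measurable_fst))))

/-- The densities of the rounds, regrouped by player. A player is needed because incompleteness of
the run is recorded in the factors of the players, and an empty product is `1`. -/
theorem aliveDensity_mul_ite (π : Protocol n 𝒰 𝒳 𝒴 μ) (hn : 0 < n) (m : ℕ) (u : 𝒰)
    (x : Fin n → 𝒳) (h : Fin m → 𝒴) :
    π.aliveDensity m u x h * (if π.speaker m u h = none then 1 else 0) =
      ∏ j, π.playerFactor u j ⟨m, h⟩ (x j) := by
  by_cases hc : π.IsComplete u ⟨m, h⟩
  · simp only [playerFactor, if_pos hc]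
    rw [Finset.prod_comm, if_pos hc.2, mul_one]
    refine Finset.prod_congr rfl fun t _ => ?_
    have ht := hc.1 t
    obtain ⟨j, hj⟩ := Option.ne_none_iff_exists'.mp ht
    change π.speaker t u (Fin.take t t.2.le h) = some j at hj
    simp [roundDensity, hj]
  · rw [Finset.prod_eq_zero (Finset.mem_univ (⟨0, hn⟩ : Fin n)) (by
      rw [playerFactor, if_neg hc])]
    split_ifs with hm
    · have : ∃ t : Fin m, π.speaker t u (Fin.take t t.2.le h) = none := by
        by_contra! hcon
        exact hc ⟨hcon, hm⟩
      obtain ⟨t, ht⟩ := this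
      rw [mul_one, aliveDensity]
      exact Finset.prod_eq_zero (Finset.mem_univ t) (by simp [roundDensity, ht])
    · simp

theorem measurable_ite_speaker (π : Protocol n 𝒰 𝒳 𝒴 μ) (t : ℕ) :
    Measurable (Function.uncurry fun (q : 𝒰 × (Fin n → 𝒳)) (h : Fin t → 𝒴) =>
      if π.speaker t q.1 h = none then (1 : ℝ≥0∞) else 0) :=
  Measurable.ite (measurableSet_preimage (f := fun q : (𝒰 × (Fin n → 𝒳)) × (Fin t → 𝒴) =>
    (q.1.1, q.2)) (by fun_prop) (π.measurableSet_speaker t none)) measurable_const measurable_const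

/-- The density of the transcript at `(u, y^*)` when the inputs are independent and the input of
player `j` has law `ν j`. -/
def transcriptDensity (π : Protocol n 𝒰 𝒳 𝒴 μ) (ν : Fin n → Measure 𝒳) (q : 𝒰 × Messages 𝒴) :
    ℝ≥0∞ :=
  ∏ j, ∫⁻ x, π.playerFactor q.1 j q.2 x ∂(ν j)

theorem measurable_lintegral_playerFactor (π : Protocol n 𝒰 𝒳 𝒴 μ) (ν : Measure 𝒳)
    [SFinite ν] (j : Fin n) :
    Measurable fun q : 𝒰 × Messages 𝒴 => ∫⁻ x, π.playerFactor q.1 j q.2 x ∂ν :=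
  ((π.measurable_playerFactor j).comp (g := fun q : Messages 𝒴 × (𝒰 × 𝒳) =>
    π.playerFactor q.2.1 j q.1 q.2.2)
    (f := fun q : (𝒰 × Messages 𝒴) × 𝒳 => (q.1.2, (q.1.1, q.2)))
    (by fun_prop)).lintegral_prod_right'

theorem measurable_transcriptDensity (π : Protocol n 𝒰 𝒳 𝒴 μ) (ν : Fin n → Measure 𝒳)
    [∀ j, IsProbabilityMeasure (ν j)] : Measurable (π.transcriptDensity ν) :=
  Finset.measurable_prod _ fun j _ => π.measurable_lintegral_playerFactor (ν j) j

variable [SigmaFinite μ]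

theorem roundKernel_apply (π : Protocol n 𝒰 𝒳 𝒴 μ) (t : ℕ)
    (q : (𝒰 × (Fin n → 𝒳)) × (Fin t → 𝒴)) :
    π.roundKernel t q = μ.withDensity (π.roundDensity t q.1.1 q.1.2 q.2) := by
  rw [roundKernel, Kernel.withDensity_apply _ (π.measurable_roundDensity t), Kernel.const_apply]
  rfl

theorem roundKernel_apply_univ (π : Protocol n 𝒰 𝒳 𝒴 μ) (t : ℕ)
    (q : (𝒰 × (Fin n → 𝒳)) × (Fin t → 𝒴)) :
    π.roundKernel t q Set.univ = if π.speaker t q.1.1 q.2 = none then 0 else 1 := by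
  rw [roundKernel_apply, withDensity_apply _ .univ, Measure.restrict_univ]
  rcases h : π.speaker t q.1.1 q.2 with _ | j
  · simp [roundDensity, h]
  · simp [roundDensity, h, π.lintegral_density]

/-- In particular `roundKernel` is s-finite, so that the composition product in the definition of
`aliveKernel` does not take its default value `0`. -/
instance (π : Protocol n 𝒰 𝒳 𝒴 μ) (t : ℕ) : IsFiniteKernel (π.roundKernel t) :=
  ⟨1, ENNReal.one_lt_top, fun q => by rw [roundKernel_apply_univ]; split_ifs <;> simp⟩

theorem aliveKernel_apply (π : Protocol n 𝒰 𝒳 𝒴 μ) (t : ℕ) (u : 𝒰) (x : Fin n → 𝒳) :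
    π.aliveKernel t (u, x) = (Measure.pi fun _ => μ).withDensity (π.aliveDensity t u x) := by
  induction t with
  | zero =>
    rw [aliveKernel, Kernel.const_apply, Measure.pi_of_empty (x := Fin.elim0)]
    have : π.aliveDensity 0 u x = 1 := by ext h; simp [aliveDensity]
    rw [this, withDensity_one]
  | succ t ih =>
    refine Measure.ext_of_lintegral _ fun F hF => ?_
    have hsn := measurable_snoc (𝒴 := 𝒴) t
    have hr : Measurable fun q : (Fin t → 𝒴) × 𝒴 => π.roundDensity t u x q.1 q.2 :=
      (π.measurable_roundDensity t).comp
        (g := fun q : ((𝒰 × (Fin n → 𝒳)) × (Fin t → 𝒴)) × 𝒴 =>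
          π.roundDensity t q.1.1.1 q.1.1.2 q.1.2 q.2)
        (f := fun q : (Fin t → 𝒴) × 𝒴 => (((u, x), q.1), q.2)) (by fun_prop)
    have hFs : Measurable fun q : (Fin t → 𝒴) × 𝒴 =>
      F (Fin.snoc (α := fun _ => 𝒴) q.1 q.2) := hF.comp hsn
    rw [aliveKernel, Kernel.map_apply _ hsn, lintegral_map hF hsn,
      Kernel.lintegral_compProd _ _ _ hFs, ih,
      lintegral_withDensity_eq_lintegral_mul _ (π.measurable_aliveDensity (t + 1) u x) hF,
      lintegral_pi_snoc μ t ((π.measurable_aliveDensity (t + 1) u x).mul hF)]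
    have e : ∀ h : Fin t → 𝒴, ∫⁻ y, F (Fin.snoc (α := fun _ => 𝒴) h y)
        ∂(π.roundKernel t ((u, x), h)) =
        ∫⁻ y, π.roundDensity t u x h y * F (Fin.snoc (α := fun _ => 𝒴) h y) ∂μ := fun h => by
      have h1 : Measurable fun y => π.roundDensity t u x h y := hr.comp measurable_prodMk_left
      have h2 : Measurable fun y => F (Fin.snoc (α := fun _ => 𝒴) h y) :=
        hFs.comp measurable_prodMk_left
      rw [roundKernel_apply]
      exact lintegral_withDensity_eq_lintegral_mul _ h1 h2
    have hrF : Measurable fun q : (Fin t → 𝒴) × 𝒴 =>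
      π.roundDensity t u x q.1 q.2 * F (Fin.snoc (α := fun _ => 𝒴) q.1 q.2) := hr.mul hFs
    simp only [e]
    rw [lintegral_withDensity_eq_lintegral_mul _ (π.measurable_aliveDensity t u x)
      hrF.lintegral_prod_right']
    refine lintegral_congr fun h => ?_
    simp only [Pi.mul_apply, aliveDensity_snoc, mul_assoc]
    exact (lintegral_const_mul _ (hrF.comp measurable_prodMk_left)).symm

theorem lintegral_messagesKernel (π : Protocol n 𝒰 𝒳 𝒴 μ) (u : 𝒰) (x : Fin n → 𝒳)
    {F : Messages 𝒴 → ℝ≥0∞} (hF : Measurable F) :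
    ∫⁻ y, F y ∂(π.messagesKernel (u, x)) =
      ∑' t : ℕ, ∫⁻ h, (if π.speaker t u h = none then 1 else 0) * F ⟨t, h⟩
        ∂(π.aliveKernel t (u, x)) := by
  rw [messagesKernel, Kernel.sum_apply, lintegral_sum_measure]
  refine tsum_congr fun t => ?_
  have hmk := (measurableEmbedding_messagesMk (𝒴 := 𝒴) t).measurable
  rw [Kernel.map_apply _ hmk, lintegral_map hF hmk,
    Kernel.lintegral_withDensity _ (π.measurable_ite_speaker t) _ (g := fun h => F ⟨t, h⟩)
      (hF.comp hmk)]

/-- Given the public randomness and the inputs, the factors of the players multiply up to the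
density of the message sequence. -/
theorem messagesKernel_apply (π : Protocol n 𝒰 𝒳 𝒴 μ) (hn : 0 < n) (u : 𝒰) (x : Fin n → 𝒳) :
    π.messagesKernel (u, x) =
      (messagesMeasure μ).withDensity fun y => ∏ j, π.playerFactor u j y (x j) := by
  have hpf : Measurable fun y : Messages 𝒴 => ∏ j, π.playerFactor u j y (x j) :=
    Finset.measurable_prod _ fun j _ => (π.measurable_playerFactor j).comp
      (f := fun y : Messages 𝒴 => (y, (u, x j))) (by fun_prop)
  refine Measure.ext_of_lintegral _ fun F hF => ?_
  rw [lintegral_messagesKernel π u x hF, lintegral_withDensity_eq_lintegral_mul _ hpf hF,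
    lintegral_messagesMeasure]
  refine tsum_congr fun t => ?_
  have hmk := (measurableEmbedding_messagesMk (𝒴 := 𝒴) t).measurable
  have hite : Measurable fun h : Fin t → 𝒴 => if π.speaker t u h = none then (1 : ℝ≥0∞) else 0 :=
    (π.measurable_ite_speaker t).comp (f := fun h => ((u, x), h)) (by fun_prop)
  rw [aliveKernel_apply, lintegral_withDensity_eq_lintegral_mul _
    (π.measurable_aliveDensity t u x) (g := fun h => (if π.speaker t u h = none then 1 else 0) *
      F ⟨t, h⟩) (hite.mul (hF.comp hmk))]
  refine lintegral_congr fun h => ?_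
  rw [Pi.mul_apply, Pi.mul_apply, ← aliveDensity_mul_ite π hn, mul_assoc]

/-- In every round, the mass that is still alive is split into the mass that stops and the mass
that remains alive. -/
theorem aliveKernel_apply_univ_eq (π : Protocol n 𝒰 𝒳 𝒴 μ) (t : ℕ) (q : 𝒰 × (Fin n → 𝒳)) :
    π.aliveKernel t q Set.univ =
      ∫⁻ h, (if π.speaker t q.1 h = none then 1 else 0) ∂(π.aliveKernel t q) +
        π.aliveKernel (t + 1) q Set.univ := by
  have hite : Measurable fun h : Fin t → 𝒴 =>
      if π.speaker t q.1 h = none then (1 : ℝ≥0∞) else 0 :=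
    (π.measurable_ite_speaker t).comp (f := fun h => (q, h)) (by fun_prop)
  have e : π.aliveKernel (t + 1) q Set.univ =
      ∫⁻ h, (if π.speaker t q.1 h = none then 0 else 1) ∂(π.aliveKernel t q) := by
    rw [aliveKernel, Kernel.map_apply' _ (measurable_snoc t) _ .univ, Set.preimage_univ,
      Kernel.compProd_apply .univ]
    exact lintegral_congr fun h => roundKernel_apply_univ π t (q, h)
  rw [e, ← lintegral_add_left hite]
  have : ∀ h : Fin t → 𝒴, ((if π.speaker t q.1 h = none then (1 : ℝ≥0∞) else 0) +
      if π.speaker t q.1 h = none then 0 else 1) = 1 := fun h => by split_ifs <;> simp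
  simp [this]

theorem messagesKernel_apply_univ_le (π : Protocol n 𝒰 𝒳 𝒴 μ) (q : 𝒰 × (Fin n → 𝒳)) :
    π.messagesKernel q Set.univ ≤ 1 := by
  obtain ⟨u, x⟩ := q
  rw [← lintegral_one, lintegral_messagesKernel π u x measurable_const]
  simp only [mul_one]
  refine ENNReal.tsum_le_of_sum_range_le fun T => ?_
  have h : ∑ t ∈ Finset.range T, ∫⁻ h, (if π.speaker t u h = none then 1 else 0)
      ∂(π.aliveKernel t (u, x)) + π.aliveKernel T (u, x) Set.univ = 1 := by
    induction T with
    | zero => simp [aliveKernel]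
    | succ T ih =>
      rw [Finset.sum_range_succ, add_assoc, ← aliveKernel_apply_univ_eq π T (u, x)]
      exact ih
  exact le_self_add.trans h.le

instance (π : Protocol n 𝒰 𝒳 𝒴 μ) : IsFiniteKernel π.messagesKernel :=
  ⟨1, ENNReal.one_lt_top, π.messagesKernel_apply_univ_le⟩

theorem lintegral_transcriptDensity_mul (π : Protocol n 𝒰 𝒳 𝒴 μ) (hn : 0 < n) (ρ : Measure 𝒰)
    [IsProbabilityMeasure ρ] (ν : Fin n → Measure 𝒳) [∀ j, IsProbabilityMeasure (ν j)]
    {F : 𝒰 × Messages 𝒴 → ℝ≥0∞} (hF : Measurable F) :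
    ∫⁻ q, π.transcriptDensity ν q * F q ∂(ρ.prod (messagesMeasure μ)) =
      ∫⁻ q, ∫⁻ y, F (q.1, y) ∂(π.messagesKernel q) ∂(ρ.prod (Measure.pi ν)) := by
  have hpf : Measurable fun q : ((𝒰 × (Fin n → 𝒳)) × Messages 𝒴) =>
      ∏ j, π.playerFactor q.1.1 j q.2 (q.1.2 j) :=
    Finset.measurable_prod _ fun j _ => (π.measurable_playerFactor j).comp
      (f := fun q : ((𝒰 × (Fin n → 𝒳)) × Messages 𝒴) => (q.2, (q.1.1, q.1.2 j))) (by fun_prop)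
  have e : ∀ q : 𝒰 × (Fin n → 𝒳), ∫⁻ y, F (q.1, y) ∂(π.messagesKernel q) =
      ∫⁻ y, (∏ j, π.playerFactor q.1 j y (q.2 j)) * F (q.1, y) ∂(messagesMeasure μ) := by
    rintro ⟨u, x⟩
    rw [messagesKernel_apply π hn]
    exact lintegral_withDensity_eq_lintegral_mul _
      (hpf.comp (f := fun y => ((u, x), y)) measurable_prodMk_left)
      (hF.comp (f := fun y => (u, y)) measurable_prodMk_left)
  have hm : Measurable fun q : (𝒰 × (Fin n → 𝒳)) × Messages 𝒴 =>
      (∏ j, π.playerFactor q.1.1 j q.2 (q.1.2 j)) * F (q.1.1, q.2) :=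
    hpf.mul (hF.comp (by fun_prop))
  have hm' : Measurable fun q => π.transcriptDensity ν q * F q :=
    (π.measurable_transcriptDensity ν).mul hF
  simp only [e]
  rw [lintegral_prod _ hm'.aemeasurable,
    lintegral_prod _ hm.lintegral_prod_right'.aemeasurable]
  refine lintegral_congr fun u => ?_
  have hu : Measurable (Function.uncurry fun (x : Fin n → 𝒳) (y : Messages 𝒴) =>
      (∏ j, π.playerFactor u j y (x j)) * F (u, y)) :=
    hm.comp (f := fun q : (Fin n → 𝒳) × Messages 𝒴 => ((u, q.1), q.2)) (by fun_prop)
  refine Eq.trans ?_ (lintegral_lintegral_swap hu.aemeasurable).symm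
  refine lintegral_congr fun y => ?_
  have hx : Measurable fun x : Fin n → 𝒳 => ∏ j, π.playerFactor u j y (x j) :=
    hpf.comp (f := fun x => ((u, x), y)) (by fun_prop)
  rw [lintegral_mul_const _ hx, lintegral_pi_prod ν (f := fun j x => π.playerFactor u j y x)
    fun j => (π.measurable_playerFactor j).comp (f := fun x => (y, (u, x))) (by fun_prop)]
  rfl

/-- The joint law of public randomness and messages has the density `transcriptDensity`. -/
theorem transcriptLaw_eq_map (π : Protocol n 𝒰 𝒳 𝒴 μ) (hn : 0 < n) (ρ : Measure 𝒰)
    [IsProbabilityMeasure ρ] (ν : Measure 𝒳) [IsProbabilityMeasure ν] :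
    π.transcriptLaw ρ ν = ((ρ.prod (messagesMeasure μ)).withDensity
      (π.transcriptDensity fun _ => ν)).map Prod.swap := by
  refine Measure.ext_of_lintegral _ fun F hF => ?_
  have hF' : Measurable fun q : (𝒰 × (Fin n → 𝒳)) × Messages 𝒴 => F (q.2, q.1.1) :=
    hF.comp (by fun_prop)
  rw [transcriptLaw, lintegral_map hF (by fun_prop), lintegral_map hF measurable_swap,
    lintegral_withDensity_eq_lintegral_mul _ (π.measurable_transcriptDensity _)
      (g := fun q => F q.swap) (hF.comp measurable_swap), Measure.lintegral_compProd hF']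
  exact (π.lintegral_transcriptDensity_mul hn ρ (fun _ => ν) (hF.comp measurable_swap)).symm

theorem transcriptLaw_univ (π : Protocol n 𝒰 𝒳 𝒴 μ) (ρ : Measure 𝒰)
    [IsProbabilityMeasure ρ] (ν : Measure 𝒳) [IsProbabilityMeasure ν] :
    π.transcriptLaw ρ ν Set.univ =
      ∫⁻ q, π.messagesKernel q Set.univ ∂(ρ.prod (Measure.pi fun _ => ν)) := by
  rw [transcriptLaw, Measure.map_apply (by fun_prop) .univ, Set.preimage_univ,
    Measure.compProd_apply .univ]
  rfl

instance (π : Protocol n 𝒰 𝒳 𝒴 μ) (ρ : Measure 𝒰)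
    [IsProbabilityMeasure ρ] (ν : Measure 𝒳) [IsProbabilityMeasure ν] :
    IsFiniteMeasure (π.transcriptLaw ρ ν) := by
  unfold transcriptLaw; infer_instance

theorem StopsAS.ae_eq_one {π : Protocol n 𝒰 𝒳 𝒴 μ} {ρ : Measure 𝒰}
    [IsProbabilityMeasure ρ] {ν : Measure 𝒳} [IsProbabilityMeasure ν] (h : π.StopsAS ρ ν) :
    ∀ᵐ q ∂(ρ.prod (Measure.pi fun _ => ν)), π.messagesKernel q Set.univ = 1 := by
  rw [StopsAS, transcriptLaw_univ] at h
  refine ae_eq_of_ae_le_of_lintegral_le (.of_forall π.messagesKernel_apply_univ_le)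
    (by simp [h]) aemeasurable_const (by simp [h])

/-- A protocol that stops almost surely for i.i.d. inputs also does so for independent inputs with
absolutely continuous laws, so that the corresponding transcript density is a probability
density. -/
theorem lintegral_transcriptDensity (π : Protocol n 𝒰 𝒳 𝒴 μ) (hn : 0 < n) (ρ : Measure 𝒰)
    [IsProbabilityMeasure ρ] {ν₀ : Measure 𝒳} [IsProbabilityMeasure ν₀] (h : π.StopsAS ρ ν₀)
    (ν : Fin n → Measure 𝒳) [∀ j, IsProbabilityMeasure (ν j)] (hν : ∀ j, ν j ≪ ν₀) :
    ∫⁻ q, π.transcriptDensity ν q ∂(ρ.prod (messagesMeasure μ)) = 1 := by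
  have e := π.lintegral_transcriptDensity_mul hn ρ ν (F := fun _ => 1) measurable_const
  simp only [mul_one, lintegral_one] at e
  have hac : ρ.prod (Measure.pi ν) ≪ ρ.prod (Measure.pi fun _ => ν₀) :=
    Measure.AbsolutelyContinuous.rfl.prod (absolutelyContinuous_pi (fun _ => ν₀) ν hν)
  rw [e, lintegral_congr_ae (hac.ae_le h.ae_eq_one), lintegral_one, measure_univ]

/-- The protocol without public randomness that is obtained by fixing the value `u` of the public
randomness. -/
def freeze (π : Protocol n 𝒰 𝒳 𝒴 μ) (u : 𝒰) : Protocol n Unit 𝒳 𝒴 μ where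
  speaker t _ h := π.speaker t u h
  density t _ h x y := π.density t u h x y
  measurableSet_speaker t o := measurableSet_preimage
    (f := fun q : Unit × (Fin t → 𝒴) => (u, q.2)) (by fun_prop) (π.measurableSet_speaker t o)
  measurable_density t := (π.measurable_density t).comp
    (f := fun q : Unit × (Fin t → 𝒴) × 𝒳 × 𝒴 => (u, q.2)) (by fun_prop)
  lintegral_density t _ h x := π.lintegral_density t u h x

theorem Uses.freeze {π : Protocol n 𝒰 𝒳 𝒴 μ} {𝒲 : Set (ℕ → Set (Kernel 𝒳 𝒴) × Fin n)}
    (h : π.Uses 𝒲) (u : 𝒰) : (π.freeze u).Uses 𝒲 := fun _ m y hy => h u m y hy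

theorem StopsAS.ae_freeze {π : Protocol n 𝒰 𝒳 𝒴 μ} (hn : 0 < n) {ρ : Measure 𝒰}
    [IsProbabilityMeasure ρ] {ν : Measure 𝒳} [IsProbabilityMeasure ν] (h : π.StopsAS ρ ν) :
    ∀ᵐ u ∂ρ, (π.freeze u).StopsAS (Measure.dirac ()) ν := by
  filter_upwards [Measure.ae_ae_of_ae_prod h.ae_eq_one] with u hu
  have e : ∀ x, (π.freeze u).messagesKernel ((), x) = π.messagesKernel (u, x) := fun x => by
    rw [messagesKernel_apply _ hn, messagesKernel_apply _ hn]
    rfl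
  rw [StopsAS, transcriptLaw_univ, lintegral_prod _ (by
    exact (Kernel.measurable_coe _ .univ).aemeasurable), lintegral_dirac]
  simp only [e]
  rw [lintegral_congr_ae hu, lintegral_one, measure_univ]

end Protocol

/-! ### The information contraction bound -/

/-- Changing the law of an input from `p` to `q = (1 + a φ) p` changes the mean of `W` by
`a E_p[φ W]`. For `a ≠ 0` the product `φ W` is integrable; for `a = 0` both sides vanish, whatever
the value of the integral. -/
theorem toReal_lintegral_sub_eq {𝒳 : Type*} [MeasurableSpace 𝒳] {p q : Measure 𝒳}
    [IsProbabilityMeasure p] [IsProbabilityMeasure q] (hqp : q ≪ p) {a : ℝ} {φ : 𝒳 → ℝ}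
    (hd : (fun x => (q.rnDeriv p x).toReal) =ᵐ[p] fun x => 1 + a * φ x)
    {W : 𝒳 → ℝ≥0∞} (hW : Measurable W) (hWp : ∫⁻ x, W x ∂p ≠ ∞) (hWq : ∫⁻ x, W x ∂q ≠ ∞) :
    (∫⁻ x, W x ∂q).toReal - (∫⁻ x, W x ∂p).toReal = a * ∫ x, φ x * (W x).toReal ∂p := by
  have hip : Integrable (fun x => (W x).toReal) p :=
    integrable_toReal_of_lintegral_ne_top hW.aemeasurable hWp
  have hiq : Integrable (fun x => (W x).toReal) q :=
    integrable_toReal_of_lintegral_ne_top hW.aemeasurable hWq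
  rw [← integral_toReal hW.aemeasurable (ae_lt_top hW hWq),
    ← integral_toReal hW.aemeasurable (ae_lt_top hW hWp),
    ← integral_rnDeriv_smul hqp, ← integral_sub ((integrable_rnDeriv_smul_iff hqp).mpr hiq) hip,
    ← integral_const_mul]
  refine integral_congr_ae ?_
  filter_upwards [hd] with x hx
  simp only [smul_eq_mul, hx]
  ring

namespace Protocol

variable {n : ℕ} {𝒰 𝒳 𝒴 : Type*} [MeasurableSpace 𝒰] [MeasurableSpace 𝒳] [MeasurableSpace 𝒴]
  {μ : Measure 𝒴}

/-- The input laws when the players in `S` have inputs from `q` and all others from `p`. -/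
def hybrid (p q : Measure 𝒳) (S : Finset (Fin n)) (j : Fin n) : Measure 𝒳 :=
  if j ∈ S then q else p

instance (p q : Measure 𝒳) [IsProbabilityMeasure p] [IsProbabilityMeasure q]
    (S : Finset (Fin n)) (j : Fin n) : IsProbabilityMeasure (hybrid p q S j) := by
  unfold hybrid; split_ifs <;> infer_instance

theorem transcriptDensity_hybrid_mul (π : Protocol n 𝒰 𝒳 𝒴 μ) (p q : Measure 𝒳)
    {A B : Finset (Fin n)} (h : Disjoint A B) (ω : 𝒰 × Messages 𝒴) :
    π.transcriptDensity (hybrid p q A) ω * π.transcriptDensity (hybrid p q B) ω =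
      π.transcriptDensity (hybrid p q (A ∪ B)) ω * π.transcriptDensity (hybrid p q ∅) ω := by
  simp only [transcriptDensity, ← Finset.prod_mul_distrib]
  refine Finset.prod_congr rfl fun j _ => ?_
  by_cases hA : j ∈ A
  · have hB : j ∉ B := Finset.disjoint_left.mp h hA
    simp [hybrid, hA, hB]
  · by_cases hB : j ∈ B <;> simp [hybrid, hA, hB, mul_comm]

theorem measurable_effectiveChannel (π : Protocol n 𝒰 𝒳 𝒴 μ) (u : 𝒰) (ν : Measure 𝒳) (j : Fin n)
    (y : Messages 𝒴) : Measurable (π.effectiveChannel u ν j y) :=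
  ((π.measurable_playerFactor j).comp (f := fun x => (y, (u, x))) (by fun_prop)).mul_const _

/-- Averaging the effective channel of player `j` over the law `q` of its input gives the density
of the transcript when only player `j` has an input from `q`. -/
theorem lintegral_effectiveChannel_hybrid (π : Protocol n 𝒰 𝒳 𝒴 μ) (p q : Measure 𝒳) (u : 𝒰)
    (j : Fin n) (y : Messages 𝒴) :
    ∫⁻ x, π.effectiveChannel u p j y x ∂q = π.transcriptDensity (hybrid p q {j}) (u, y) := by
  simp only [effectiveChannel]
  have hm : Measurable fun x => π.playerFactor u j y x :=
    (π.measurable_playerFactor j).comp (f := fun x => (y, (u, x))) (by fun_prop)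
  rw [lintegral_mul_const _ hm, transcriptDensity, ← Finset.mul_prod_erase _ _ (Finset.mem_univ j)]
  congr 1
  · simp [hybrid]
  · refine Finset.prod_congr rfl fun l hl => ?_
    simp [hybrid, (Finset.mem_erase.mp hl).1]

theorem lintegral_effectiveChannel (π : Protocol n 𝒰 𝒳 𝒴 μ) (p q : Measure 𝒳) (u : 𝒰)
    (j : Fin n) (y : Messages 𝒴) :
    ∫⁻ x, π.effectiveChannel u p j y x ∂p = π.transcriptDensity (hybrid p q ∅) (u, y) := by
  rw [lintegral_effectiveChannel_hybrid]
  simp [transcriptDensity, hybrid]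

/-- Changing the law of the input of a single player costs at most the chi-square divergence, which
is the information carried by the effective channel of that player. -/
theorem lintegral_sq_sqrt_sub_le (π : Protocol n 𝒰 𝒳 𝒴 μ) {p q : Measure 𝒳}
    [IsProbabilityMeasure p] [IsProbabilityMeasure q] (hqp : q ≪ p) {a : ℝ} {φ : 𝒳 → ℝ}
    (hd : (fun x => (q.rnDeriv p x).toReal) =ᵐ[p] fun x => 1 + a * φ x) (u : 𝒰) (j : Fin n)
    (h0 : ∀ᵐ y ∂(messagesMeasure μ), π.transcriptDensity (hybrid p q ∅) (u, y) ≠ ∞)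
    (h1 : ∀ᵐ y ∂(messagesMeasure μ), π.transcriptDensity (hybrid p q {j}) (u, y) ≠ ∞) :
    ∫⁻ y, ENNReal.ofReal ((√(π.transcriptDensity (hybrid p q {j}) (u, y)).toReal -
      √(π.transcriptDensity (hybrid p q ∅) (u, y)).toReal) ^ 2) ∂(messagesMeasure μ) ≤
      ENNReal.ofReal (a ^ 2) * π.effectiveInformation u p j φ := by
  rw [effectiveInformation, ← lintegral_const_mul' _ _ ENNReal.ofReal_ne_top]
  refine lintegral_mono_ae ?_
  filter_upwards [h0, h1] with y hy0 hy1
  refine (ofReal_sq_sqrt_sub_le hy0).trans (le_of_eq ?_)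
  rw [← lintegral_effectiveChannel_hybrid] at hy1 ⊢
  rw [← lintegral_effectiveChannel π p q u j] at hy0 ⊢
  rw [toReal_lintegral_sub_eq hqp hd (π.measurable_effectiveChannel u p j y) hy0 hy1, mul_pow,
    ENNReal.ofReal_mul (sq_nonneg _), mul_div_assoc]

end Protocol

open Protocol

/-- The squared distances between the transcript law of a fixed `z` and those of its neighbours sum
to at most six times the total effective information. -/
theorem sum_tvDist_sq_le {k n : ℕ} {𝒰 𝒳 𝒴 : Type*} [MeasurableSpace 𝒰] [MeasurableSpace 𝒳]
    [MeasurableSpace 𝒴] {μ : Measure 𝒴} [SigmaFinite μ] (hn : 0 < n)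
    {p : (Fin k → ℤˣ) → Measure 𝒳} [∀ z, IsProbabilityMeasure (p z)]
    {α : ℝ} {a : (Fin k → ℤˣ) → Fin k → ℝ} {φ : (Fin k → ℤˣ) → Fin k → 𝒳 → ℝ}
    (hp : DensitiesExist p α a φ) {𝒲 : Set (ℕ → Set (Kernel 𝒳 𝒴) × Fin n)}
    (ρ : Measure 𝒰) [IsProbabilityMeasure ρ] (P : Protocol n 𝒰 𝒳 𝒴 μ) (hP : P.Uses 𝒲)
    (hT : ∀ z, P.StopsAS ρ (p z)) (z : Fin k → ℤˣ) :
    ∑ i, ENNReal.ofReal (tvDist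
        ((ρ.prod (messagesMeasure μ)).withDensity (P.transcriptDensity fun _ => p z))
        ((ρ.prod (messagesMeasure μ)).withDensity
          (P.transcriptDensity fun _ => p (flip z i))) ^ 2) ≤
      6 * ENNReal.ofReal (α ^ 2) *
        ∑ j : Fin n, ⨆ (z : Fin k → ℤˣ) (π : Protocol n Unit 𝒳 𝒴 μ) (_ : π.Uses 𝒲)
          (_ : ∀ z', π.StopsAS (Measure.dirac ()) (p z')),
          ∑ i : Fin k, π.effectiveInformation () (p z) j (φ z i) := by
  set m := ρ.prod (messagesMeasure μ) with hm
  set f : Fin k → Finset (Fin n) → 𝒰 × Messages 𝒴 → ℝ≥0∞ := fun i S =>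
    P.transcriptDensity (hybrid (p z) (p (flip z i)) S) with hf
  have hmeas : ∀ i S, Measurable (f i S) := fun i S => P.measurable_transcriptDensity _
  have hone : ∀ i S, ∫⁻ ω, f i S ω ∂m = 1 := fun i S =>
    P.lintegral_transcriptDensity hn ρ (hT z) _ fun j => by
      unfold hybrid
      split_ifs
      · exact hp.absolutelyContinuous z i
      · exact Measure.AbsolutelyContinuous.rfl
  have huniv : ∀ i, P.transcriptDensity (fun _ => p (flip z i)) = f i Finset.univ := fun i => by
    simp [hf, transcriptDensity, hybrid, funext_iff]
  have hempty : ∀ i, P.transcriptDensity (fun _ => p z) = f i ∅ := fun i => by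
    simp [hf, transcriptDensity, hybrid, funext_iff]
  have hsix : ∀ i, ENNReal.ofReal (tvDist (m.withDensity (P.transcriptDensity fun _ => p z))
      (m.withDensity (P.transcriptDensity fun _ => p (flip z i))) ^ 2) ≤
      6 * ∑ j, hellinger m (f i {j}) (f i ∅) := fun i => by
    rw [tvDist_comm, huniv i, hempty i]
    exact (tvDist_sq_le_hellinger (hmeas i _) (hmeas i _) (hone i _) (hone i _)).trans
      (hellinger_le_six_mul_sum (f i) (hmeas i) (hone i)
        fun A B hAB ω => P.transcriptDensity_hybrid_mul _ _ hAB ω)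
  refine (Finset.sum_le_sum fun i _ => hsix i).trans ?_
  rw [← Finset.mul_sum, mul_assoc]
  refine mul_le_mul_right ?_ 6
  rw [Finset.sum_comm, Finset.mul_sum]
  refine Finset.sum_le_sum fun j _ => ?_
  have hfin : ∀ i S, ∀ᵐ u ∂ρ, ∀ᵐ y ∂(messagesMeasure μ), f i S (u, y) ≠ ∞ := fun i S =>
    Measure.ae_ae_of_ae_prod (by
      filter_upwards [ae_lt_top (hmeas i S) (by rw [hone]; simp)] with ω h using h.ne)
  have hsq : ∀ i, Measurable fun ω => ENNReal.ofReal
      ((√(f i {j} ω).toReal - √(f i ∅ ω).toReal) ^ 2) := fun i => by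
    have h1 := hmeas i {j}
    have h2 := hmeas i ∅
    fun_prop
  have hfub : ∀ i, hellinger m (f i {j}) (f i ∅) = ∫⁻ u, ∫⁻ y, ENNReal.ofReal
      ((√(f i {j} (u, y)).toReal - √(f i ∅ (u, y)).toReal) ^ 2) ∂(messagesMeasure μ) ∂ρ :=
    fun i => lintegral_prod _ (hsq i).aemeasurable
  simp only [hfub]
  rw [← lintegral_finsetSum _ fun i _ => (hsq i).lintegral_prod_right']
  set B := ⨆ (z : Fin k → ℤˣ) (π : Protocol n Unit 𝒳 𝒴 μ) (_ : π.Uses 𝒲)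
    (_ : ∀ z', π.StopsAS (Measure.dirac ()) (p z')),
    ∑ i : Fin k, π.effectiveInformation () (p z) j (φ z i) with hB
  have hae : ∀ᵐ u ∂ρ, ∑ i, ∫⁻ y, ENNReal.ofReal
      ((√(f i {j} (u, y)).toReal - √(f i ∅ (u, y)).toReal) ^ 2) ∂(messagesMeasure μ) ≤
      ENNReal.ofReal (α ^ 2) * B := by
    filter_upwards [ae_all_iff.mpr fun i => hfin i ∅, ae_all_iff.mpr fun i => hfin i {j},
      ae_all_iff.mpr fun z' => (hT z').ae_freeze hn] with u hu0 hu1 hu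
    calc ∑ i, ∫⁻ y, ENNReal.ofReal
          ((√(f i {j} (u, y)).toReal - √(f i ∅ (u, y)).toReal) ^ 2) ∂(messagesMeasure μ)
        ≤ ∑ i, ENNReal.ofReal (α ^ 2) * (P.freeze u).effectiveInformation () (p z) j (φ z i) := by
          refine Finset.sum_le_sum fun i _ => ?_
          refine (P.lintegral_sq_sqrt_sub_le (hp.absolutelyContinuous z i) (hp.rnDeriv_eq z i) u j
            (hu0 i) (hu1 i)).trans (mul_le_mul_left (ENNReal.ofReal_le_ofReal ?_) _)
          rw [← sq_abs]
          exact pow_le_pow_left₀ (abs_nonneg _) (hp.abs_le z i) 2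
      _ = ENNReal.ofReal (α ^ 2) *
          ∑ i, (P.freeze u).effectiveInformation () (p z) j (φ z i) := (Finset.mul_sum _ _ _).symm
      _ ≤ ENNReal.ofReal (α ^ 2) * B := by
          refine mul_le_mul_right ?_ _
          rw [hB]
          exact le_iSup₂_of_le z (P.freeze u) (le_iSup₂_of_le (hP.freeze u) hu le_rfl)
  calc ∫⁻ u, ∑ i, ∫⁻ y, ENNReal.ofReal
        ((√(f i {j} (u, y)).toReal - √(f i ∅ (u, y)).toReal) ^ 2) ∂(messagesMeasure μ) ∂ρ
      ≤ ∫⁻ _, ENNReal.ofReal (α ^ 2) * B ∂ρ := lintegral_mono_ae hae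
    _ = ENNReal.ofReal (α ^ 2) * B := by rw [lintegral_const, measure_univ, mul_one]

/-- The bound for the law of any statistic `T` of public randomness and messages. -/
theorem averageDiscrepancy_map_le {k n : ℕ} {𝒰 𝒳 𝒴 Ω : Type*} [MeasurableSpace 𝒰]
    [MeasurableSpace 𝒳] [MeasurableSpace 𝒴] [MeasurableSpace Ω] {μ : Measure 𝒴} [SigmaFinite μ]
    {τ : ℝ} (hτ0 : 0 < τ) (hτ1 : τ < 1)
    {p : (Fin k → ℤˣ) → Measure 𝒳} [∀ z, IsProbabilityMeasure (p z)]
    {α : ℝ} {a : (Fin k → ℤˣ) → Fin k → ℝ} {φ : (Fin k → ℤˣ) → Fin k → 𝒳 → ℝ}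
    (hp : DensitiesExist p α a φ) {𝒲 : Set (ℕ → Set (Kernel 𝒳 𝒴) × Fin n)}
    (ρ : Measure 𝒰) [IsProbabilityMeasure ρ] (P : Protocol n 𝒰 𝒳 𝒴 μ) (hP : P.Uses 𝒲)
    (hT : ∀ z, P.StopsAS ρ (p z)) {T : Messages 𝒴 × 𝒰 → Ω} (hTm : Measurable T) :
    ENNReal.ofReal (averageDiscrepancy τ (fun z => (P.transcriptLaw ρ (p z)).map T) ^ 2) ≤
      contractionBound μ 𝒲 p α φ := by
  obtain ⟨z, hz⟩ := exists_averageDiscrepancy_sq_le hτ0 hτ1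
    fun z => (P.transcriptLaw ρ (p z)).map T
  refine (ENNReal.ofReal_le_ofReal hz).trans ?_
  rcases Nat.eq_zero_or_pos k with hk | hk
  · subst hk
    simp
  rcases Nat.eq_zero_or_pos n with hn | hn
  -- Without players, no message depends on the inputs.
  · subst hn
    have : ∀ z z', P.transcriptLaw ρ (p z) = P.transcriptLaw ρ (p z') := fun z z' => by
      rw [transcriptLaw, transcriptLaw, Subsingleton.elim (fun _ : Fin 0 => p z) fun _ => p z']
    simp [this _ z, tvDist]
  have hk' : (0 : ℝ) < k := by exact_mod_cast hk
  rw [ENNReal.ofReal_mul (by positivity), ENNReal.ofReal_sum_of_nonneg fun i _ => sq_nonneg _]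
  have hfin : ∀ z, IsFiniteMeasure ((ρ.prod (messagesMeasure μ)).withDensity
      (P.transcriptDensity fun _ => p z)) := fun z => isFiniteMeasure_withDensity (by
    rw [P.lintegral_transcriptDensity hn ρ (hT z) _ fun _ => Measure.AbsolutelyContinuous.rfl]
    simp)
  have hmap : ∀ z, (P.transcriptLaw ρ (p z)).map T = ((ρ.prod (messagesMeasure μ)).withDensity
      (P.transcriptDensity fun _ => p z)).map (T ∘ Prod.swap) := fun z => by
    rw [P.transcriptLaw_eq_map hn, Measure.map_map hTm measurable_swap]
  have hle : ∑ i, ENNReal.ofReal (tvDist ((P.transcriptLaw ρ (p z)).map T)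
      ((P.transcriptLaw ρ (p (flip z i))).map T) ^ 2) ≤ _ :=
    (Finset.sum_le_sum fun i _ => ENNReal.ofReal_le_ofReal (pow_le_pow_left₀ (tvDist_nonneg _ _)
      (by
        rw [hmap, hmap]
        exact tvDist_map_le _ _ (hTm.comp measurable_swap)) 2)).trans
      (sum_tvDist_sq_le hn hp ρ P hP hT z)
  refine (mul_le_mul_right hle _).trans ?_
  rw [contractionBound, ← mul_assoc, ← mul_assoc]
  refine mul_le_mul_left (mul_le_mul_left ?_ _) _
  rw [one_div, ENNReal.ofReal_inv_of_pos hk', ENNReal.ofReal_natCast, mul_comm, div_eq_mul_inv]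
  exact mul_le_mul_left (by norm_num) _

end FullyInteractive

end
open FullyInteractive in
theorem mainTheorem9 {k n : ℕ} {𝒰 𝒳 𝒴 : Type*} [MeasurableSpace 𝒰] [MeasurableSpace 𝒳]
    [MeasurableSpace 𝒴] (μ : Measure 𝒴) [SigmaFinite μ]
    (τ : ℝ) (hτ : τ ∈ Set.Ioc (0 : ℝ) (1 / 2))
    (p : (Fin k → ℤˣ) → Measure 𝒳) [∀ z, IsProbabilityMeasure (p z)]
    (α : ℝ) (a : (Fin k → ℤˣ) → Fin k → ℝ) (φ : (Fin k → ℤˣ) → Fin k → 𝒳 → ℝ)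
    (hp : DensitiesExist p α a φ)
    (𝒲 : Set (ℕ → Set (Kernel 𝒳 𝒴) × Fin n))
    (ρ : Measure 𝒰) [IsProbabilityMeasure ρ]
    (P : Protocol n 𝒰 𝒳 𝒴 μ) (hP : P.Uses 𝒲) (hT : ∀ z, P.StopsAS ρ (p z)) :
    ENNReal.ofReal (averageDiscrepancy τ (fun z => P.messagesLaw ρ (p z)) ^ 2) ≤
        contractionBound μ 𝒲 p α φ ∧
      ENNReal.ofReal (averageDiscrepancy τ (fun z => P.transcriptLaw ρ (p z)) ^ 2) ≤
        contractionBound μ 𝒲 p α φ := by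
  have hτ1 : τ < 1 := hτ.2.trans_lt (by norm_num)
  refine ⟨averageDiscrepancy_map_le hτ.1 hτ1 hp ρ P hP hT measurable_fst, ?_⟩
  simpa only [Measure.map_id] using averageDiscrepancy_map_le hτ.1 hτ1 hp ρ P hP hT measurable_id
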